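/- Let $n\in\mathbb N$, let $1<q<p<n$, $p<r\le p^*:=\frac{np}{n-p}$, $0<\delta<1$, $\lambda,\beta>0$, and let $\Omega\subset\mathbb R^n$ be a bounded domain. Let $W^{1,p}_0(\Omega)$ be the closure of $C_c^\infty(\Omega)$ in $W^{1,p}(\Omega)$. Consider the problem $$(P_\lambda)\qquad -\Delta_p u-\beta\Delta_q u=\lambda u^{-\delta}+u^{r-1},\quad u>0\ \text{ in }\Omega,\qquad u=0\ \text{ on }\partial\Omega .$$ A function $u\in W^{1,p}_0(\Omega)$ is a weak solution of $(P_\lambda)$ if $u>0$ a.e. in $\Omega$ and, for every $\phi\in W^{1,p}_0(\Omega)$, $u^{-\delta}\phi\in L^1(\Omega)$ and $$\int_\Omega\big(|\nabla u|^{p-2}\nabla u\cdot\nabla\phi+\beta|\nabla u|^{q-2}\nabla u\cdot\nabla\phi-\lambda u^{-\delta}\phi-u^{r-1}\phi\big)\,dx=0 .$$ For $u\in W^{1,p}_0(\Omega)$ and $t>0$ put $$I_\lambda(u)=\frac1p\int_\Omega|\nabla u|^p\,dx+\frac{\beta}{q}\int_\Omega|\nabla u|^q\,dx-\frac{\lambda}{1-\delta}\int_\Omega|u|^{1-\delta}\,dx-\frac1r\int_\Omega|u|^r\,dx,\qquad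 J_u(t)=I_\lambda(tu),$$ and let $$N_\lambda=\{u\in W^{1,p}_0(\Omega): u\ne0,\ J_u'(1)=0\},\qquad N_\lambda^{+}=\{u\in N_\lambda: J_u''(1)>0\},\qquad N_\lambda^{-}=\{u\in N_\lambda: J_u''(1)<0\}.$$ **Theorem.** If $u\in N_\lambda^+$ with $u\ge0$ a.e. in $\Omega$ satisfies $I_\lambda(u)\le I_\lambda(w)$ for all $w\in N_\lambda^+$, then $u$ is a weak solution of $(P_\lambda)$. Likewise, if $v\in N_\lambda^-$ with $v\ge0$ a.e. in $\Omega$ satisfies $I_\lambda(v)\le I_\lambda(w)$ for all $w\in N_\lambda^-$, then $v$ is a weak solution of $(P_\lambda)$. -/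

import Mathlib

open MeasureTheory Set
open scoped ContDiff ENNReal

noncomputable section

namespace SingularPQ

variable {n : ℕ}

/-- `φ ∈ C_c^∞(Ω)`. -/
def IsTestFunction (Ω : Set (EuclideanSpace ℝ (Fin n))) (φ : EuclideanSpace ℝ (Fin n) → ℝ) :
    Prop :=
  ContDiff ℝ ∞ φ ∧ HasCompactSupport φ ∧ tsupport φ ⊆ Ω

/-- `G` is the weak (distributional) gradient of `u` in `Ω`. Functions are defined on all of `ℝⁿ`,
but only their values in `Ω`, up to null sets, matter. -/
def HasWeakGradient (Ω : Set (EuclideanSpace ℝ (Fin n))) (u : EuclideanSpace ℝ (Fin n) → ℝ)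
    (G : EuclideanSpace ℝ (Fin n) → EuclideanSpace ℝ (Fin n)) : Prop :=
  LocallyIntegrableOn u Ω ∧ LocallyIntegrableOn G Ω ∧
    ∀ φ, IsTestFunction Ω φ → ∫ x in Ω, u x • gradient φ x = -∫ x in Ω, φ x • G x

open Classical in
/-- The weak gradient `∇u` of `u` in `Ω` (determined almost everywhere in `Ω` when it exists, and
`0` by convention when it does not). -/
def weakGradient (Ω : Set (EuclideanSpace ℝ (Fin n))) (u : EuclideanSpace ℝ (Fin n) → ℝ) :
    EuclideanSpace ℝ (Fin n) → EuclideanSpace ℝ (Fin n) :=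
  if h : ∃ G, HasWeakGradient Ω u G then h.choose else 0

/-- `u ∈ W^{1,p}(Ω)`. -/
def MemW1p (Ω : Set (EuclideanSpace ℝ (Fin n))) (p : ℝ) (u : EuclideanSpace ℝ (Fin n) → ℝ) :
    Prop :=
  MemLp u (ENNReal.ofReal p) (volume.restrict Ω) ∧
  (∃ G, HasWeakGradient Ω u G) ∧
  MemLp (weakGradient Ω u) (ENNReal.ofReal p) (volume.restrict Ω)

/-- `u ∈ W^{1,p}_0(Ω)`: the closure of `C_c^∞(Ω)` in `W^{1,p}(Ω)`. -/
def MemW1p0 (Ω : Set (EuclideanSpace ℝ (Fin n))) (p : ℝ) (u : EuclideanSpace ℝ (Fin n) → ℝ) :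
    Prop :=
  MemW1p Ω p u ∧
  ∀ ε : ℝ≥0∞, ε ≠ 0 → ∃ φ, IsTestFunction Ω φ ∧
    eLpNorm (fun x => u x - φ x) (ENNReal.ofReal p) (volume.restrict Ω) ≤ ε ∧
    eLpNorm (fun x => weakGradient Ω u x - gradient φ x)
      (ENNReal.ofReal p) (volume.restrict Ω) ≤ ε

/-- The energy functional
`I(u) = (1/p) ∫ |∇u|^p + (β/q) ∫ |∇u|^q - (lam/(1-δ)) ∫ |u|^(1-δ) - (1/r) ∫ |u|^r`. -/
def energy (Ω : Set (EuclideanSpace ℝ (Fin n))) (p q r δ β lam : ℝ)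
    (u : EuclideanSpace ℝ (Fin n) → ℝ) : ℝ :=
  1 / p * (∫ x in Ω, ‖weakGradient Ω u x‖ ^ p)
    + β * (1 / q) * (∫ x in Ω, ‖weakGradient Ω u x‖ ^ q)
    - lam / (1 - δ) * (∫ x in Ω, |u x| ^ (1 - δ))
    - 1 / r * (∫ x in Ω, |u x| ^ r)

/-- The fibering map `J_u(t) = I(t u)`. -/
def fibering (Ω : Set (EuclideanSpace ℝ (Fin n))) (p q r δ β lam : ℝ)
    (u : EuclideanSpace ℝ (Fin n) → ℝ) (t : ℝ) : ℝ :=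
  energy Ω p q r δ β lam (fun x => t * u x)

/-- The Nehari manifold: all `u ∈ W^{1,p}_0(Ω)`, `u ≠ 0`, with `J_u'(1) = 0`. -/
def nehari (Ω : Set (EuclideanSpace ℝ (Fin n))) (p q r δ β lam : ℝ) :
    Set (EuclideanSpace ℝ (Fin n) → ℝ) :=
  {u | MemW1p0 Ω p u ∧ ¬ (∀ᵐ x ∂(volume.restrict Ω), u x = 0) ∧
    deriv (fibering Ω p q r δ β lam u) 1 = 0}

/-- The part of the Nehari manifold where `J_u''(1) > 0`. -/
def nehariPlus (Ω : Set (EuclideanSpace ℝ (Fin n))) (p q r δ β lam : ℝ) :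
    Set (EuclideanSpace ℝ (Fin n) → ℝ) :=
  {u | u ∈ nehari Ω p q r δ β lam ∧ 0 < deriv (deriv (fibering Ω p q r δ β lam u)) 1}

/-- The part of the Nehari manifold where `J_u''(1) < 0`. -/
def nehariMinus (Ω : Set (EuclideanSpace ℝ (Fin n))) (p q r δ β lam : ℝ) :
    Set (EuclideanSpace ℝ (Fin n) → ℝ) :=
  {u | u ∈ nehari Ω p q r δ β lam ∧ deriv (deriv (fibering Ω p q r δ β lam u)) 1 < 0}

/-- `u` is a weak solution of `-Δ_p u - β Δ_q u = lam u^(-δ) + u^(r-1)`, `u > 0` in `Ω`, `u = 0` on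
`∂Ω`. The integrability of `u^(-δ) φ` is part of the notion: for the other three terms it is
automatic when `q < p < r ≤ p*` and `Ω` is bounded. -/
def IsWeakSolution (Ω : Set (EuclideanSpace ℝ (Fin n))) (p q r δ β lam : ℝ)
    (u : EuclideanSpace ℝ (Fin n) → ℝ) : Prop :=
  MemW1p0 Ω p u ∧ (∀ᵐ x ∂(volume.restrict Ω), 0 < u x) ∧
  ∀ φ, MemW1p0 Ω p φ →
    IntegrableOn (fun x => u x ^ (-δ) * φ x) Ω ∧
    ∫ x in Ω, (‖weakGradient Ω u x‖ ^ (p - 2) *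
          inner ℝ (weakGradient Ω u x) (weakGradient Ω φ x)
        + β * (‖weakGradient Ω u x‖ ^ (q - 2) *
          inner ℝ (weakGradient Ω u x) (weakGradient Ω φ x))
        - lam * (u x ^ (-δ) * φ x) - u x ^ (r - 1) * φ x) = 0

end SingularPQ

end

/-!
A minimizer `u ≥ 0` of the energy over `N⁺` or `N⁻` is first shown to be minimal in every direction
`φ ∈ W^{1,p}_0(Ω)` up to rescaling: there are `ε → 0+` and `s → 1` with
`I(s u) ≤ I(s (u + ε φ))` (`IsDirectionalMin`). Indeed the fibering map of `w` depends only on four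
integrals, which are continuous along `ε ↦ u + ε φ`, and a nondegenerate critical point of the
fibering map at `1` persists under perturbation (`exists_local_min_of_perturbation`), so that
`u + ε φ` can be projected to `N^±` by a factor `t → 1`. For `N⁺` the fibering map of `u + ε φ` is
minimal at `t`, so one may take `s = 1`; for `N⁻` that of `u` is maximal at `1`, so one may take
`s = t`.

The three regular terms of the energy are differentiable along `ε ↦ u + ε φ`; the one of exponent
`r` requires the Sobolev embedding `MemW1p0.memLp_sobolev`. For `φ ≥ 0`, dividing by `ε` and applying
Fatou's lemma to the singular term bounds `∫ u^(-δ) φ`, with the convention `0^(-δ) = ∞`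
(`IsAdmissible.lintegral_singular_le`). With bump functions for `φ` this already forces `u > 0`
almost everywhere (`IsAdmissible.ae_pos`), without a maximum principle.

The bound depends on `φ` only through the norm of `∇φ`. Applying it to the smooth functions
`√(φ_k² + η_k²) - η_k`, where the test functions `φ_k` tend to `φ`, gives `u^(-δ) φ ∈ L¹` for all
`φ ∈ W^{1,p}_0(Ω)` (`IsAdmissible.integrableOn_singular`). Since
`||u + ε φ|^(1-δ) - u^(1-δ)| ≤ ε u^(-δ) |φ|` wherever `u > 0`, the singular term is then
differentiable along `ε ↦ u + ε φ` whatever the sign of `u + ε φ`, by dominated convergence.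
Directional minimality for `φ` and `-φ` yields the equation.
-/

open Filter Topology

namespace SingularPQ

variable {n : ℕ} {Ω : Set (EuclideanSpace ℝ (Fin n))}
  {u v φ : EuclideanSpace ℝ (Fin n) → ℝ}
  {G H : EuclideanSpace ℝ (Fin n) → EuclideanSpace ℝ (Fin n)} {p : ℝ}

/-! ### Weak gradients -/

theorem IsTestFunction.continuous_gradient (hφ : IsTestFunction Ω φ) :
    Continuous (gradient φ) :=
  (InnerProductSpace.toDual ℝ _).symm.continuous.comp (hφ.1.continuous_fderiv (by simp))

theorem IsTestFunction.hasCompactSupport_gradient (hφ : IsTestFunction Ω φ) :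
    HasCompactSupport (gradient φ) :=
  (hφ.2.1.fderiv ℝ).comp_left (g := (InnerProductSpace.toDual ℝ _).symm) (map_zero _)

theorem tsupport_gradient_subset : tsupport (gradient φ) ⊆ tsupport φ := by
  refine (closure_mono ?_).trans (tsupport_fderiv_subset ℝ (f := φ))
  intro x hx h
  exact hx (by simp [gradient, h])

theorem integrableOn_smul_of_locallyIntegrableOn (hu : LocallyIntegrableOn u Ω)
    (hG : Continuous G) (hGc : HasCompactSupport G) (hGs : tsupport G ⊆ Ω) :
    IntegrableOn (fun x => u x • G x) Ω := by
  have h : IntegrableOn (fun x => u x • G x) (tsupport G) :=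
    (hu.integrableOn_compact_subset hGs hGc).smul_continuousOn hG.continuousOn hGc
  have h2 : Integrable (fun x => u x • G x) := by
    rwa [← integrableOn_iff_integrable_of_support_subset (s := tsupport G)]
    intro x hx
    exact subset_tsupport G fun h => hx (by simp [h])
  exact h2.integrableOn

theorem integrableOn_test_smul (hφ : IsTestFunction Ω φ) (hG : LocallyIntegrableOn G Ω) :
    IntegrableOn (fun x => φ x • G x) Ω := by
  have h : IntegrableOn (fun x => φ x • G x) (tsupport φ) :=
    (hG.integrableOn_compact_subset hφ.2.2 hφ.2.1).continuousOn_smul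
      hφ.1.continuous.continuousOn hφ.2.1
  have h2 : Integrable (fun x => φ x • G x) := by
    rwa [← integrableOn_iff_integrable_of_support_subset (s := tsupport φ)]
    intro x hx
    exact subset_tsupport φ fun h => hx (by simp [h])
  exact h2.integrableOn

theorem HasWeakGradient.ae_eq (hΩ : IsOpen Ω) (hG : HasWeakGradient Ω u G)
    (hH : HasWeakGradient Ω u H) : G =ᵐ[volume.restrict Ω] H := by
  have h := hΩ.ae_eq_zero_of_integral_contDiff_smul_eq_zero (hG.2.1.sub hH.2.1) (μ := volume) ?_
  · rw [← ae_restrict_iff' hΩ.measurableSet] at h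
    filter_upwards [h] with x hx using sub_eq_zero.1 hx
  · intro g hg hgc hgs
    have hgt : IsTestFunction Ω g := ⟨hg, hgc, hgs⟩
    rw [← setIntegral_eq_integral_of_forall_compl_eq_zero (s := Ω)
      (fun x hx => by simp [image_eq_zero_of_notMem_tsupport fun h => hx (hgs h)])]
    simp only [Pi.sub_apply, smul_sub]
    rw [integral_sub (integrableOn_test_smul hgt hG.2.1) (integrableOn_test_smul hgt hH.2.1),
      sub_eq_zero, ← neg_inj, ← hG.2.2 g hgt, hH.2.2 g hgt]

theorem hasWeakGradient_weakGradient (h : ∃ G, HasWeakGradient Ω u G) :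
    HasWeakGradient Ω u (weakGradient Ω u) := by
  rw [weakGradient, dif_pos h]
  exact h.choose_spec

theorem HasWeakGradient.weakGradient_ae_eq (hΩ : IsOpen Ω) (hG : HasWeakGradient Ω u G) :
    weakGradient Ω u =ᵐ[volume.restrict Ω] G :=
  (hasWeakGradient_weakGradient ⟨G, hG⟩).ae_eq hΩ hG

theorem HasWeakGradient.linearComb (hG : HasWeakGradient Ω u G) (hH : HasWeakGradient Ω v H)
    (a b : ℝ) :
    HasWeakGradient Ω (fun x => a * u x + b * v x) (fun x => a • G x + b • H x) := by
  refine ⟨(hG.1.smul a).add (hH.1.smul b), (hG.2.1.smul a).add (hH.2.1.smul b), fun φ hφ => ?_⟩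
  have i1 := integrableOn_smul_of_locallyIntegrableOn hG.1 hφ.continuous_gradient
    hφ.hasCompactSupport_gradient (tsupport_gradient_subset.trans hφ.2.2)
  have i2 := integrableOn_smul_of_locallyIntegrableOn hH.1 hφ.continuous_gradient
    hφ.hasCompactSupport_gradient (tsupport_gradient_subset.trans hφ.2.2)
  have j1 := integrableOn_test_smul hφ hG.2.1
  have j2 := integrableOn_test_smul hφ hH.2.1
  simp only [add_smul, mul_smul, smul_add, smul_comm (φ _)]
  rw [integral_add (f := fun x => a • u x • gradient φ x) (g := fun x => b • v x • gradient φ x)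
      (i1.smul a) (i2.smul b),
    integral_add (f := fun x => a • φ x • G x) (g := fun x => b • φ x • H x)
      (j1.smul a) (j2.smul b)]
  simp only [integral_smul]
  rw [hG.2.2 φ hφ, hH.2.2 φ hφ, smul_neg, smul_neg, neg_add]

/-- Integration by parts: the classical gradient of a test function is its weak gradient. -/
theorem IsTestFunction.hasWeakGradient (hφ : IsTestFunction Ω φ) :
    HasWeakGradient Ω φ (gradient φ) := by
  refine ⟨hφ.1.continuous.locallyIntegrable.locallyIntegrableOn _,
    hφ.continuous_gradient.locallyIntegrable.locallyIntegrableOn _, fun ψ hψ => ?_⟩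
  have i1 : Integrable fun x => φ x • gradient ψ x :=
    (hφ.1.continuous.smul hψ.continuous_gradient).integrable_of_hasCompactSupport
      (hφ.2.1.smul_right)
  have i2 : Integrable fun x => ψ x • gradient φ x :=
    (hψ.1.continuous.smul hφ.continuous_gradient).integrable_of_hasCompactSupport
      (hψ.2.1.smul_right)
  rw [setIntegral_eq_integral_of_forall_compl_eq_zero (s := Ω)
      (fun x hx => by simp [image_eq_zero_of_notMem_tsupport fun h => hx (hφ.2.2 h)]),
    setIntegral_eq_integral_of_forall_compl_eq_zero (s := Ω)
      (fun x hx => by simp [image_eq_zero_of_notMem_tsupport fun h => hx (hψ.2.2 h)])]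
  refine ext_inner_left ℝ fun w => ?_
  rw [inner_neg_right, ← integral_inner i1, ← integral_inner i2]
  have e : ∀ (f g : EuclideanSpace ℝ (Fin n) → ℝ) x, inner ℝ w (f x • gradient g x)
      = f x * fderiv ℝ g x w := fun f g x => by
    rw [inner_smul_right, real_inner_comm, gradient, InnerProductSpace.toDual_symm_apply]
  have k1 := i1.const_inner (𝕜 := ℝ) w
  have k2 := i2.const_inner (𝕜 := ℝ) w
  simp only [e] at k1 k2 ⊢
  rw [integral_mul_fderiv_eq_neg_fderiv_mul_of_integrable (by simpa only [mul_comm] using k2) k1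
    ((hφ.1.continuous.mul hψ.1.continuous).integrable_of_hasCompactSupport hφ.2.1.mul_right)
    (fun x _ => hφ.1.differentiable (by simp) x) (fun x _ => hψ.1.differentiable (by simp) x)]
  simp only [mul_comm]

/-! ### The space `W^{1,p}_0(Ω)` -/

theorem IsTestFunction.memW1p0 (hΩ : IsOpen Ω) (hφ : IsTestFunction Ω φ) : MemW1p0 Ω p φ := by
  have hw := hφ.hasWeakGradient.weakGradient_ae_eq hΩ
  refine ⟨⟨(hφ.1.continuous.memLp_of_hasCompactSupport hφ.2.1).restrict _,
    ⟨_, hφ.hasWeakGradient⟩, (memLp_congr_ae hw).2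
    ((hφ.continuous_gradient.memLp_of_hasCompactSupport hφ.hasCompactSupport_gradient).restrict _)⟩,
    fun ε _ => ⟨φ, hφ, by simp, ?_⟩⟩
  have : (fun x => weakGradient Ω φ x - gradient φ x) =ᵐ[volume.restrict Ω] 0 := by
    filter_upwards [hw] with x hx using by simp [hx]
  rw [eLpNorm_congr_ae this]
  simp

theorem IsTestFunction.linearComb (hu : IsTestFunction Ω u) (hv : IsTestFunction Ω v) (a b : ℝ) :
    IsTestFunction Ω (fun x => a * u x + b * v x) := by
  refine ⟨(contDiff_const.mul hu.1).add (contDiff_const.mul hv.1),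
    (hu.2.1.mul_left).add (hv.2.1.mul_left), ?_⟩
  refine (tsupport_add (fun x => a * u x) fun x => b * v x).trans (union_subset ?_ ?_)
  · exact (tsupport_mul_subset_right).trans hu.2.2
  · exact (tsupport_mul_subset_right).trans hv.2.2

theorem MemW1p0.weakGradient_linearComb (hΩ : IsOpen Ω) (hu : MemW1p0 Ω p u)
    (hv : MemW1p0 Ω p v) (a b : ℝ) :
    weakGradient Ω (fun x => a * u x + b * v x) =ᵐ[volume.restrict Ω]
      fun x => a • weakGradient Ω u x + b • weakGradient Ω v x :=
  ((hasWeakGradient_weakGradient hu.1.2.1).linearComb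
    (hasWeakGradient_weakGradient hv.1.2.1) a b).weakGradient_ae_eq hΩ

theorem eLpNorm_linearComb_le {E : Type*} [NormedAddCommGroup E] [NormedSpace ℝ E]
    {f g : EuclideanSpace ℝ (Fin n) → E} {μ : Measure (EuclideanSpace ℝ (Fin n))}
    {P : ℝ≥0∞} (hP : 1 ≤ P) (hf : AEStronglyMeasurable f μ) (hg : AEStronglyMeasurable g μ)
    (a b : ℝ) {ε : ℝ≥0∞} (h1 : eLpNorm f P μ ≤ ε) (h2 : eLpNorm g P μ ≤ ε) :
    eLpNorm (fun x => a • f x + b • g x) P μ ≤ (‖a‖ₑ + ‖b‖ₑ) * ε := by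
  refine (eLpNorm_add_le (hf.const_smul a) (hg.const_smul b) hP).trans ?_
  rw [add_mul]
  refine add_le_add ((eLpNorm_const_smul_le (c := a)).trans ?_)
    ((eLpNorm_const_smul_le (c := b)).trans ?_) <;> gcongr

theorem MemW1p0.linearComb (hΩ : IsOpen Ω) (hp : 1 ≤ p) (hu : MemW1p0 Ω p u)
    (hv : MemW1p0 Ω p v) (a b : ℝ) : MemW1p0 Ω p (fun x => a * u x + b * v x) := by
  have hw := hu.weakGradient_linearComb hΩ hv a b
  have hP : 1 ≤ ENNReal.ofReal p := by simpa using hp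
  refine ⟨⟨(hu.1.1.const_mul a).add (hv.1.1.const_mul b), ⟨_,
    (hasWeakGradient_weakGradient hu.1.2.1).linearComb (hasWeakGradient_weakGradient hv.1.2.1) a b⟩,
    (memLp_congr_ae hw).2 ((hu.1.2.2.const_smul a).add (hv.1.2.2.const_smul b))⟩, fun ε hε => ?_⟩
  have hM : ‖a‖ₑ + ‖b‖ₑ ≠ ⊤ := by simp
  obtain ⟨ε', hε', hε''⟩ : ∃ ε' : ℝ≥0∞, ε' ≠ 0 ∧ (‖a‖ₑ + ‖b‖ₑ) * ε' ≤ ε := by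
    by_cases h0 : ‖a‖ₑ + ‖b‖ₑ = 0
    · exact ⟨1, one_ne_zero, by simp [h0]⟩
    · exact ⟨ε / (‖a‖ₑ + ‖b‖ₑ), ENNReal.div_ne_zero.2 ⟨hε, hM⟩, ENNReal.mul_div_le⟩
  obtain ⟨φ, hφ, h1, h2⟩ := hu.2 ε' hε'
  obtain ⟨ψ, hψ, h3, h4⟩ := hv.2 ε' hε'
  refine ⟨_, hφ.linearComb hψ a b, le_trans (le_of_eq ?_) ((eLpNorm_linearComb_le hP
    (hu.1.1.1.sub hφ.1.continuous.aestronglyMeasurable)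
    (hv.1.1.1.sub hψ.1.continuous.aestronglyMeasurable) a b h1 h3).trans hε''),
    le_trans (le_of_eq (eLpNorm_congr_ae ?_)) ((eLpNorm_linearComb_le hP
    (hu.1.2.2.1.sub hφ.continuous_gradient.aestronglyMeasurable)
    (hv.1.2.2.1.sub hψ.continuous_gradient.aestronglyMeasurable) a b h2 h4).trans hε'')⟩
  · congr 1
    ext x
    simp only [smul_eq_mul, Pi.sub_apply]
    ring
  · filter_upwards [hw] with x hx
    have hg : gradient (fun x => a * φ x + b * ψ x) x = a • gradient φ x + b • gradient ψ x := by
      have d1 := hφ.1.differentiable (by simp) x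
      have d2 := hψ.1.differentiable (by simp) x
      simp only [gradient]
      rw [fderiv_fun_add (d1.const_mul a) (d2.const_mul b), fderiv_const_mul d1,
        fderiv_const_mul d2]
      simp
    rw [hx, hg]
    simp only [Pi.sub_apply, smul_sub]
    abel

end SingularPQ

/-! ### Elementary inequalities for powers -/

namespace SingularPQ

theorem rpow_sub_one_mul_le {a b p : ℝ} (ha : 0 ≤ a) (hb : 0 ≤ b) (hp : 1 < p) :
    a ^ (p - 1) * b ≤ a ^ p + b ^ p := by
  have e : ∀ c : ℝ, 0 ≤ c → c ^ (p - 1) * c = c ^ p := fun c hc => by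
    rw [← Real.rpow_add_one' hc (by linarith), sub_add_cancel]
  rcases le_total a b with h | h
  · calc a ^ (p - 1) * b ≤ b ^ (p - 1) * b := by
          gcongr
      _ ≤ a ^ p + b ^ p := by rw [e b hb]; linarith [Real.rpow_nonneg ha p]
  · calc a ^ (p - 1) * b ≤ a ^ (p - 1) * a := by gcongr
      _ ≤ a ^ p + b ^ p := by rw [e a ha]; linarith [Real.rpow_nonneg hb p]

theorem abs_norm_rpow_mul_inner_le {E : Type*} [NormedAddCommGroup E] [InnerProductSpace ℝ E]
    (x y : E) (p : ℝ) : |‖x‖ ^ (p - 2) * inner ℝ x y| ≤ ‖x‖ ^ (p - 1) * ‖y‖ := by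
  by_cases hx : x = 0
  · simp only [hx, inner_zero_left, mul_zero, abs_zero]
    positivity
  have hx' : 0 < ‖x‖ := norm_pos_iff.2 hx
  rw [abs_mul, abs_of_nonneg (by positivity : (0 : ℝ) ≤ ‖x‖ ^ (p - 2))]
  calc ‖x‖ ^ (p - 2) * |inner ℝ x y| ≤ ‖x‖ ^ (p - 2) * (‖x‖ * ‖y‖) := by
        gcongr
        exact abs_real_inner_le_norm x y
    _ = ‖x‖ ^ (p - 1) * ‖y‖ := by
        rw [← mul_assoc, ← Real.rpow_add_one hx'.ne']
        ring_nf

theorem abs_abs_add_rpow_sub_le {a h s : ℝ} (hs0 : 0 ≤ s) (hs1 : s ≤ 1) :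
    |(|a + h| ^ s - |a| ^ s)| ≤ |h| ^ s := by
  have key : ∀ b c : ℝ, |b| ^ s ≤ |c| ^ s + |b - c| ^ s := fun b c =>
    (Real.rpow_le_rpow (abs_nonneg _) (by
      have := abs_add_le c (b - c)
      rwa [add_sub_cancel] at this) hs0).trans
      (Real.rpow_add_le_add_rpow (abs_nonneg _) (abs_nonneg _) hs0 hs1)
  rw [abs_le]
  have h1 := key (a + h) a
  have h2 := key a (a + h)
  rw [add_sub_cancel_left] at h1
  rw [sub_add_cancel_left, abs_neg] at h2
  constructor <;> linarith

/-- By concavity of `x ↦ x ^ s`, the increment `||a + h| ^ s - a ^ s|` is at most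
`a ^ (s - 1) * |h|`, even when `h` is not small compared with `a`. -/
theorem abs_abs_add_rpow_sub_le_mul {a h s : ℝ} (ha : 0 < a) (hs0 : 0 ≤ s) (hs1 : s ≤ 1) :
    |(|a + h| ^ s - a ^ s)| ≤ a ^ (s - 1) * |h| := by
  set b := |a + h| with hb
  have hb0 : 0 ≤ b := abs_nonneg _
  have hba : |b - a| ≤ |h| := by
    have := abs_abs_sub_abs_le (a + h) a
    rwa [add_sub_cancel_left, abs_of_pos ha] at this
  set y := b / a with hy
  have hy0 : 0 ≤ y := by positivity
  have hb' : b = a * y := by rw [hy]; field_simp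
  have h1 : |y ^ s - 1| ≤ |y - 1| := by
    rcases le_total y 1 with h | h
    · have h2 : y ≤ y ^ s := by
        rcases hy0.eq_or_lt with h0 | h0
        · rw [← h0]; positivity
        · simpa using Real.rpow_le_rpow_of_exponent_ge h0 h hs1
      have h3 : y ^ s ≤ 1 := Real.rpow_le_one hy0 h hs0
      rw [abs_of_nonpos (by linarith), abs_of_nonpos (by linarith)]
      linarith
    · have h2 : y ^ s ≤ y := by simpa using Real.rpow_le_rpow_of_exponent_le h hs1
      have h3 : 1 ≤ y ^ s := Real.one_le_rpow h hs0
      rw [abs_of_nonneg (by linarith), abs_of_nonneg (by linarith)]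
      linarith
  have e1 : b ^ s - a ^ s = a ^ s * (y ^ s - 1) := by
    rw [hb', Real.mul_rpow ha.le hy0]; ring
  have e2 : a ^ s = a ^ (s - 1) * a := by
    rw [← Real.rpow_add_one ha.ne', sub_add_cancel]
  have e3 : b - a = a * (y - 1) := by rw [hb']; ring
  calc |b ^ s - a ^ s| = a ^ s * |y ^ s - 1| := by
        rw [e1, abs_mul, abs_of_nonneg (by positivity : 0 ≤ a ^ s)]
    _ ≤ a ^ s * |y - 1| := by gcongr
    _ = a ^ (s - 1) * |b - a| := by rw [e3, abs_mul, abs_of_pos ha, e2]; ring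
    _ ≤ a ^ (s - 1) * |h| := by gcongr

/-- The concave function `x ↦ x ^ s` lies below its tangent at `a + h`. -/
theorem mul_rpow_sub_one_mul_le {a h s : ℝ} (ha : 0 ≤ a) (hah : 0 < a + h)
    (hs0 : 0 ≤ s) (hs1 : s ≤ 1) :
    s * (a + h) ^ (s - 1) * h ≤ (a + h) ^ s - a ^ s := by
  set b := a + h with hb
  have hz : -1 ≤ a / b - 1 := by
    have : 0 ≤ a / b := by positivity
    linarith
  have key := rpow_one_add_le_one_add_mul_self hz hs0 hs1
  rw [add_sub_cancel, Real.div_rpow ha hah.le, div_le_iff₀ (by positivity)] at key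
  have e2 : b ^ s = b ^ (s - 1) * b := by
    rw [← Real.rpow_add_one hah.ne', sub_add_cancel]
  have e3 : (1 + s * (a / b - 1)) * b ^ s = b ^ s - s * b ^ (s - 1) * h := by
    have : h = b - a := by rw [hb]; ring
    rw [e2, this]
    field_simp
    ring
  linarith

/-! ### Integrals of powers of norms -/

section

variable {α E : Type*} {m : MeasurableSpace α} {μ : Measure α}
  [NormedAddCommGroup E] [InnerProductSpace ℝ E] {G H : α → E} {p : ℝ}

theorem integrable_norm_rpow_of_memLp {E : Type*} [NormedAddCommGroup E] {G : α → E}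
    (hp : 0 < p) (hG : MemLp G (ENNReal.ofReal p) μ) :
    Integrable (fun x => ‖G x‖ ^ p) μ := by
  have := hG.integrable_norm_rpow (by simpa using hp) (by simp)
  rwa [ENNReal.toReal_ofReal hp.le] at this

/-- Differentiation under the integral sign: the Gateaux derivative of `∫ ‖G‖ ^ p`. -/
theorem hasDerivAt_integral_norm_add_smul_rpow (hp : 1 < p)
    (hG : MemLp G (ENNReal.ofReal p) μ) (hH : MemLp H (ENNReal.ofReal p) μ) :
    Integrable (fun x => ‖G x‖ ^ (p - 2) * inner ℝ (G x) (H x)) μ ∧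
    HasDerivAt (fun ε : ℝ => ∫ x, ‖G x + ε • H x‖ ^ p ∂μ)
      (p * ∫ x, ‖G x‖ ^ (p - 2) * inner ℝ (G x) (H x) ∂μ) 0 := by
  have hp0 : 0 < p := by linarith
  have hbd : Integrable (fun x => p * (‖G x‖ + ‖H x‖) ^ p) μ := by
    have := integrable_norm_rpow_of_memLp hp0 (hG.norm.add hH.norm)
    refine (this.congr (ae_of_all _ fun x => ?_)).const_mul p
    simp only [Pi.add_apply]
    rw [Real.norm_of_nonneg (by positivity)]
  have hmeas : ∀ ε : ℝ, AEStronglyMeasurable (fun x => ‖G x + ε • H x‖ ^ p) μ := fun ε =>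
    ((hG.1.add (hH.1.const_smul ε)).norm.aemeasurable.pow_const p).aestronglyMeasurable
  have h := hasDerivAt_integral_of_dominated_loc_of_deriv_le (μ := μ) (x₀ := (0 : ℝ))
    (s := Metric.ball 0 1) (F := fun ε x => ‖G x + ε • H x‖ ^ p)
    (F' := fun ε x => p * ‖G x + ε • H x‖ ^ (p - 2) * inner ℝ (G x + ε • H x) (H x))
    (bound := fun x => p * (‖G x‖ + ‖H x‖) ^ p)
    (Metric.ball_mem_nhds _ one_pos) (Eventually.of_forall hmeas)
    (by simpa using integrable_norm_rpow_of_memLp hp0 hG) ?_ ?_ hbd ?_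
  · simp only [zero_smul, add_zero, mul_assoc] at h
    refine ⟨?_, ?_⟩
    · have := h.1.const_mul p⁻¹
      refine this.congr (ae_of_all _ fun x => ?_)
      simp only
      field_simp
    · have h2 := h.2
      rwa [integral_const_mul] at h2
  · simp only [zero_smul, add_zero]
    exact (((hG.1.norm.aemeasurable.pow_const _).const_mul p).aestronglyMeasurable).mul
      (hG.1.inner hH.1)
  · refine ae_of_all _ fun x ε hε => ?_
    have hε1 : |ε| ≤ 1 := by simpa [Real.dist_eq] using (Metric.mem_ball.1 hε).le
    have hle : ‖G x + ε • H x‖ ≤ ‖G x‖ + ‖H x‖ := by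
      refine (norm_add_le _ _).trans ?_
      rw [norm_smul, Real.norm_eq_abs]
      gcongr
      exact mul_le_of_le_one_left (norm_nonneg _) hε1
    rw [Real.norm_eq_abs, mul_assoc, abs_mul, abs_of_pos hp0]
    gcongr
    refine (abs_norm_rpow_mul_inner_le _ _ p).trans ?_
    calc ‖G x + ε • H x‖ ^ (p - 1) * ‖H x‖
        ≤ (‖G x‖ + ‖H x‖) ^ (p - 1) * (‖G x‖ + ‖H x‖) := by
          gcongr
          exact le_add_of_nonneg_left (norm_nonneg _)
      _ = (‖G x‖ + ‖H x‖) ^ p := by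
          rw [← Real.rpow_add_one' (by positivity) (by linarith), sub_add_cancel]
  · refine ae_of_all _ fun x ε _ => ?_
    have h1 : HasDerivAt (fun ε : ℝ => G x + ε • H x) (H x) ε := by
      simpa using ((hasDerivAt_id ε).smul_const (H x)).const_add (G x)
    have h2 := (hasFDerivAt_norm_rpow (G x + ε • H x) hp).comp_hasDerivAt ε h1
    simp only [smul_apply, coe_innerSL_apply, smul_eq_mul] at h2
    exact h2

end

end SingularPQ

namespace SingularPQ

variable {n : ℕ} {Ω : Set (EuclideanSpace ℝ (Fin n))}
  {u φ : EuclideanSpace ℝ (Fin n) → ℝ} {p r : ℝ}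

/-! ### The Sobolev embedding -/

theorem norm_gradient_eq (x : EuclideanSpace ℝ (Fin n)) : ‖gradient φ x‖ = ‖fderiv ℝ φ x‖ := by
  simp [gradient]

theorem MemW1p0.exists_seq_testFunction (hp : 1 ≤ p) (hu : MemW1p0 Ω p u) :
    ∃ φ : ℕ → EuclideanSpace ℝ (Fin n) → ℝ, (∀ k, IsTestFunction Ω (φ k)) ∧
      (∀ᵐ x ∂(volume.restrict Ω), Tendsto (fun k => φ k x) atTop (𝓝 (u x))) ∧
      ∀ k, eLpNorm (gradient (φ k)) (ENNReal.ofReal p) (volume.restrict Ω) ≤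
        eLpNorm (weakGradient Ω u) (ENNReal.ofReal p) (volume.restrict Ω) + 1 := by
  have hP : 1 ≤ ENNReal.ofReal p := by simpa using hp
  have h : ∀ k : ℕ, ∃ φ, IsTestFunction Ω φ ∧
      eLpNorm (fun x => u x - φ x) (ENNReal.ofReal p) (volume.restrict Ω) ≤
        ((k : ℝ≥0∞) + 1)⁻¹ ∧
      eLpNorm (fun x => weakGradient Ω u x - gradient φ x)
        (ENNReal.ofReal p) (volume.restrict Ω) ≤ ((k : ℝ≥0∞) + 1)⁻¹ := fun k =>
    hu.2 _ (by simp)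
  choose φ hφ h1 h2 using h
  have hm : TendstoInMeasure (volume.restrict Ω) φ atTop u := by
    refine tendstoInMeasure_of_tendsto_eLpNorm (p := ENNReal.ofReal p)
      (by simpa using lt_of_lt_of_le one_pos hp)
      (fun k => (hφ k).1.continuous.aestronglyMeasurable) hu.1.1.1 ?_
    have hlim : Tendsto (fun k : ℕ => ((k : ℝ≥0∞) + 1)⁻¹) atTop (𝓝 0) := by
      have := ENNReal.tendsto_inv_nat_nhds_zero.comp (tendsto_add_atTop_nat 1)
      simpa [Function.comp_def] using this
    refine tendsto_of_tendsto_of_tendsto_of_le_of_le tendsto_const_nhds hlim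
      (fun _ => zero_le) fun k => ?_
    rw [eLpNorm_sub_comm]
    exact h1 k
  obtain ⟨ns, -, hns⟩ := hm.exists_seq_tendsto_ae
  refine ⟨fun k => φ (ns k), fun k => hφ _, hns, fun k => ?_⟩
  have e : gradient (φ (ns k)) = weakGradient Ω u
      - (fun x => weakGradient Ω u x - gradient (φ (ns k)) x) := by
    ext1 x
    simp
  have hmg : AEStronglyMeasurable (fun x => weakGradient Ω u x - gradient (φ (ns k)) x)
      (volume.restrict Ω) :=
    hu.1.2.2.1.sub (hφ _).continuous_gradient.aestronglyMeasurable
  rw [e]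
  refine (eLpNorm_sub_le hu.1.2.2.1 hmg hP).trans ?_
  gcongr
  refine (h2 _).trans ?_
  simp

/-- The Gagliardo–Nirenberg–Sobolev inequality for test functions passes to the almost everywhere
limit by Fatou's lemma. -/
theorem MemW1p0.memLp_sobolev (hΩb : Bornology.IsBounded Ω) (hp : 1 ≤ p) (hpn : p < n)
    (hr0 : 0 < r) (hr : r ≤ n * p / (n - p)) (hu : MemW1p0 Ω p u) :
    MemLp u (ENNReal.ofReal r) (volume.restrict Ω) := by
  have hp0 : 0 < p := by linarith
  obtain ⟨φ, hφ, hlim, hbd⟩ := hu.exists_seq_testFunction hp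
  set C := eLpNormLESNormFDerivOfLeConst ℝ (volume : Measure (EuclideanSpace ℝ (Fin n))) Ω
    p.toNNReal r.toNNReal with hC
  have hexp : (↑(p.toNNReal⁻¹) : ℝ) - (Module.finrank ℝ (EuclideanSpace ℝ (Fin n)) : ℝ)⁻¹
      ≤ ((r.toNNReal : ℝ))⁻¹ := by
    have hnp : 0 < (n : ℝ) - p := by linarith
    have hn : 0 < (n : ℝ) := by linarith
    rw [NNReal.coe_inv, Real.coe_toNNReal _ hp0.le, Real.coe_toNNReal _ hr0.le,
      finrank_euclideanSpace_fin]
    have : p⁻¹ - (n : ℝ)⁻¹ = (n * p / (n - p))⁻¹ := by field_simp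
    rw [this]
    exact inv_anti₀ hr0 hr
  have hk : ∀ k, eLpNorm (φ k) (ENNReal.ofReal r) (volume.restrict Ω) ≤
      C * (eLpNorm (weakGradient Ω u) (ENNReal.ofReal p) (volume.restrict Ω) + 1) := fun k => by
    have h1 := eLpNorm_le_eLpNorm_fderiv_of_le
      (μ := (volume : Measure (EuclideanSpace ℝ (Fin n)))) (s := Ω)
      (p := p.toNNReal) (q := r.toNNReal)
      ((hφ k).1.of_le (by simp)) ((subset_tsupport _).trans (hφ k).2.2)
      (by simpa using hp)
      (by rw [finrank_euclideanSpace_fin, ← NNReal.coe_lt_coe, Real.coe_toNNReal _ hp0.le]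
          simpa using hpn) hexp hΩb
    refine (eLpNorm_mono_measure _ Measure.restrict_le_self).trans (h1.trans ?_)
    gcongr
    refine le_trans (le_of_eq ?_) (hbd k)
    rw [eLpNorm_restrict_eq_of_support_subset ((subset_tsupport _).trans
      (tsupport_gradient_subset.trans (hφ k).2.2))]
    exact eLpNorm_congr_norm_ae (ae_of_all _ fun x => (norm_gradient_eq x).symm)
  refine ⟨hu.1.1.1, (Lp.eLpNorm_le_of_ae_tendsto (Eventually.of_forall hk)
    (fun k => (hφ k).1.continuous.aestronglyMeasurable) hlim).trans_lt ?_⟩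
  exact ENNReal.mul_lt_top ENNReal.coe_lt_top (ENNReal.add_lt_top.2 ⟨hu.1.2.2.2, by simp⟩)

end SingularPQ

namespace SingularPQ

/-! ### Perturbation of a nondegenerate critical point -/

/-- A nondegenerate local minimum at `1` of `f c₀` persists: for `c` near `c₀` the function `f c`
has a critical point near `1` with positive second derivative, which is a minimum on a
neighbourhood of `1` of size independent of `c`. -/
theorem exists_local_min_of_perturbation {X : Type*} [TopologicalSpace X] {f f' f'' : X → ℝ → ℝ}
    {c₀ : X} (hf : ∀ c, ∀ t, 0 < t → HasDerivAt (f c) (f' c t) t)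
    (hf' : ∀ c, ∀ t, 0 < t → HasDerivAt (f' c) (f'' c t) t)
    (hc' : ∀ t, ContinuousAt (fun c => f' c t) c₀)
    (hc'' : ContinuousAt (fun z : X × ℝ => f'' z.1 z.2) (c₀, 1))
    (h0 : f' c₀ 1 = 0) (h1 : 0 < f'' c₀ 1) :
    ∀ᶠ η in 𝓝[>] (0 : ℝ), ∀ᶠ c in 𝓝 c₀, ∃ t, 0 < t ∧ |t - 1| < η ∧ f' c t = 0 ∧ 0 < f'' c t ∧
      ∀ s, |s - 1| < η → f c t ≤ f c s := by
  obtain ⟨U, hU, V, hV, hUV⟩ := mem_nhds_prod_iff.1 (hc''.eventually (lt_mem_nhds h1))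
  obtain ⟨η₁, hη₁, hball⟩ := Metric.mem_nhds_iff.1 hV
  have hpos : ∀ c ∈ U, ∀ t, |t - 1| < η₁ → 0 < f'' c t := fun c hc t ht =>
    hUV (Set.mk_mem_prod hc (hball (by simpa [Real.dist_eq] using ht)))
  filter_upwards [Ioo_mem_nhdsGT (lt_min hη₁ one_pos)] with η hη
  have hη0 : 0 < η := hη.1
  have hηη : η < η₁ := hη.2.trans_le (min_le_left _ _)
  have hη1 : η < 1 := hη.2.trans_le (min_le_right _ _)
  have hmem : ∀ t ∈ Icc (1 - η) (1 + η), 0 < t ∧ |t - 1| < η₁ := fun t ht =>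
    ⟨by linarith [ht.1], (abs_le.2 ⟨by linarith [ht.1], by linarith [ht.2]⟩).trans_lt hηη⟩
  have hcont : ∀ c, ContinuousOn (f' c) (Icc (1 - η) (1 + η)) := fun c t ht =>
    (hf' c t (hmem t ht).1).continuousAt.continuousWithinAt
  have hmono : ∀ c ∈ U, StrictMonoOn (f' c) (Icc (1 - η) (1 + η)) := fun c hc =>
    strictMonoOn_of_deriv_pos (convex_Icc _ _) (hcont c) fun t ht => by
      rw [interior_Icc] at ht
      have := hmem t (Ioo_subset_Icc_self ht)
      rw [(hf' c t this.1).deriv]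
      exact hpos c hc t this.2
  have hl : (1 - η) ∈ Icc (1 - η) (1 + η) := ⟨le_rfl, by linarith⟩
  have hm : (1 : ℝ) ∈ Icc (1 - η) (1 + η) := ⟨by linarith, by linarith⟩
  have hr : (1 + η) ∈ Icc (1 - η) (1 + η) := ⟨by linarith, le_rfl⟩
  have hneg : f' c₀ (1 - η) < 0 := h0 ▸ hmono c₀ (mem_of_mem_nhds hU) hl hm (by linarith)
  have hpos' : 0 < f' c₀ (1 + η) := by
    have := hmono c₀ (mem_of_mem_nhds hU) hm hr (by linarith)
    rwa [h0] at this
  filter_upwards [hU, (hc' _).eventually (gt_mem_nhds hneg),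
    (hc' _).eventually (lt_mem_nhds hpos')] with c hcU hcl hcr
  obtain ⟨t, ht, ht0⟩ := intermediate_value_Ioo (by linarith) (hcont c) ⟨hcl, hcr⟩
  have htI := Ioo_subset_Icc_self ht
  refine ⟨t, (hmem t htI).1, abs_lt.2 ⟨by linarith [ht.1], by linarith [ht.2]⟩, ht0,
    hpos c hcU t (hmem t htI).2, fun s hs => ?_⟩
  have hsI : s ∈ Icc (1 - η) (1 + η) := by
    rw [abs_lt] at hs
    exact ⟨by linarith, by linarith⟩
  have hsub : ∀ {a b}, a ∈ Icc (1 - η) (1 + η) → b ∈ Icc (1 - η) (1 + η) →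
      Icc a b ⊆ Icc (1 - η) (1 + η) := fun ha hb => Icc_subset_Icc ha.1 hb.2
  have hslope : ∀ {a b}, a ∈ Icc (1 - η) (1 + η) → b ∈ Icc (1 - η) (1 + η) → a < b →
      ∃ ξ ∈ Ioo a b, f' c ξ = (f c b - f c a) / (b - a) := fun ha hb hab =>
    exists_hasDerivAt_eq_slope (f c) (f' c) hab
      (fun x hx => (hf c x (hmem x (hsub ha hb hx)).1).continuousAt.continuousWithinAt)
      fun x hx => hf c x (hmem x (hsub ha hb (Ioo_subset_Icc_self hx))).1
  rcases lt_trichotomy s t with h | h | h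
  · obtain ⟨ξ, hξ, he⟩ := hslope hsI htI h
    have : f' c ξ < 0 :=
      ht0 ▸ hmono c hcU (hsub hsI htI (Ioo_subset_Icc_self hξ)) htI hξ.2
    rw [he, div_lt_iff₀ (by linarith)] at this
    linarith
  · rw [h]
  · obtain ⟨ξ, hξ, he⟩ := hslope htI hsI h
    have : 0 < f' c ξ := by
      have := hmono c hcU htI (hsub htI hsI (Ioo_subset_Icc_self hξ)) hξ.1
      rwa [ht0] at this
    rw [he, lt_div_iff₀ (by linarith)] at this
    linarith

/-! ### Fibering maps -/

/-- The fibering map `t ↦ I(t w)`, `t > 0`, as a function of the four integrals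
`c = (∫ |∇w|^p, ∫ |∇w|^q, ∫ |w|^(1-δ), ∫ |w|^r)`. -/
noncomputable def fiber (p q r δ β lam : ℝ) (c : ℝ × ℝ × ℝ × ℝ) (t : ℝ) : ℝ :=
  1 / p * (t ^ p * c.1) + β * (1 / q) * (t ^ q * c.2.1)
    - lam / (1 - δ) * (t ^ (1 - δ) * c.2.2.1) - 1 / r * (t ^ r * c.2.2.2)

/-- The derivative of `fiber` in `t`. -/
noncomputable def fiberDeriv (p q r δ β lam : ℝ) (c : ℝ × ℝ × ℝ × ℝ) (t : ℝ) : ℝ :=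
  t ^ (p - 1) * c.1 + β * (t ^ (q - 1) * c.2.1)
    - lam * (t ^ (-δ) * c.2.2.1) - t ^ (r - 1) * c.2.2.2

/-- The second derivative of `fiber` in `t`. -/
noncomputable def fiberDeriv2 (p q r δ β lam : ℝ) (c : ℝ × ℝ × ℝ × ℝ) (t : ℝ) : ℝ :=
  (p - 1) * (t ^ (p - 2) * c.1) + β * ((q - 1) * (t ^ (q - 2) * c.2.1))
    - lam * (-δ * (t ^ (-δ - 1) * c.2.2.1)) - (r - 1) * (t ^ (r - 2) * c.2.2.2)

variable {p q r δ β lam : ℝ}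

theorem hasDerivAt_fiber (hp : p ≠ 0) (hq : q ≠ 0) (hr : r ≠ 0) (hδ : 1 - δ ≠ 0)
    (c : ℝ × ℝ × ℝ × ℝ) {t : ℝ} (ht : 0 < t) :
    HasDerivAt (fiber p q r δ β lam c) (fiberDeriv p q r δ β lam c t) t := by
  have h : ∀ a : ℝ, HasDerivAt (fun t : ℝ => t ^ a) (a * t ^ (a - 1)) t := fun a =>
    Real.hasDerivAt_rpow_const (Or.inl ht.ne')
  have := ((((((h p).mul_const c.1).const_mul (1 / p))).add
    (((h q).mul_const c.2.1).const_mul (β * (1 / q)))).sub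
    (((h (1 - δ)).mul_const c.2.2.1).const_mul (lam / (1 - δ)))).sub
    (((h r).mul_const c.2.2.2).const_mul (1 / r))
  refine this.congr_deriv ?_
  rw [fiberDeriv, show 1 - δ - 1 = -δ by ring]
  field_simp

theorem hasDerivAt_fiberDeriv (c : ℝ × ℝ × ℝ × ℝ) {t : ℝ} (ht : 0 < t) :
    HasDerivAt (fiberDeriv p q r δ β lam c) (fiberDeriv2 p q r δ β lam c t) t := by
  have h : ∀ a : ℝ, HasDerivAt (fun t : ℝ => t ^ a) (a * t ^ (a - 1)) t := fun a =>
    Real.hasDerivAt_rpow_const (Or.inl ht.ne')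
  have := (((((h (p - 1)).mul_const c.1)).add
    (((h (q - 1)).mul_const c.2.1).const_mul β)).sub
    (((h (-δ)).mul_const c.2.2.1).const_mul lam)).sub
    ((h (r - 1)).mul_const c.2.2.2)
  refine this.congr_deriv ?_
  rw [fiberDeriv2, show p - 1 - 1 = p - 2 by ring, show q - 1 - 1 = q - 2 by ring,
    show r - 1 - 1 = r - 2 by ring]
  ring

theorem continuous_fiberDeriv (t : ℝ) :
    Continuous fun c => fiberDeriv p q r δ β lam c t := by
  unfold fiberDeriv
  fun_prop

theorem continuousAt_fiberDeriv2 (c : ℝ × ℝ × ℝ × ℝ) :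
    ContinuousAt (fun z : (ℝ × ℝ × ℝ × ℝ) × ℝ => fiberDeriv2 p q r δ β lam z.1 z.2) (c, 1) := by
  unfold fiberDeriv2
  have h : ∀ a : ℝ, ContinuousAt (fun z : (ℝ × ℝ × ℝ × ℝ) × ℝ => z.2 ^ a) (c, 1) := fun a =>
    continuousAt_snd.rpow_const (Or.inl one_ne_zero)
  have := h (p - 2)
  have := h (q - 2)
  have := h (-δ - 1)
  have := h (r - 2)
  fun_prop

theorem fiber_isMin_of_perturbation (hp : p ≠ 0) (hq : q ≠ 0) (hr : r ≠ 0) (hδ : 1 - δ ≠ 0)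
    {c₀ : ℝ × ℝ × ℝ × ℝ} (h0 : fiberDeriv p q r δ β lam c₀ 1 = 0)
    (h1 : 0 < fiberDeriv2 p q r δ β lam c₀ 1) :
    ∀ᶠ η in 𝓝[>] (0 : ℝ), ∀ᶠ c in 𝓝 c₀, ∃ t, 0 < t ∧ |t - 1| < η ∧
      fiberDeriv p q r δ β lam c t = 0 ∧ 0 < fiberDeriv2 p q r δ β lam c t ∧
      ∀ s, |s - 1| < η → fiber p q r δ β lam c t ≤ fiber p q r δ β lam c s :=
  exists_local_min_of_perturbation (fun c _ ht => hasDerivAt_fiber hp hq hr hδ c ht)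
    (fun c _ ht => hasDerivAt_fiberDeriv c ht) (fun t => (continuous_fiberDeriv t).continuousAt)
    (continuousAt_fiberDeriv2 c₀) h0 h1

theorem fiber_critical_of_perturbation_of_neg (hp : p ≠ 0) (hq : q ≠ 0) (hr : r ≠ 0)
    (hδ : 1 - δ ≠ 0)
    {c₀ : ℝ × ℝ × ℝ × ℝ} (h0 : fiberDeriv p q r δ β lam c₀ 1 = 0)
    (h1 : fiberDeriv2 p q r δ β lam c₀ 1 < 0) :
    ∀ᶠ η in 𝓝[>] (0 : ℝ), ∀ᶠ c in 𝓝 c₀, ∃ t, 0 < t ∧ |t - 1| < η ∧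
      fiberDeriv p q r δ β lam c t = 0 ∧ fiberDeriv2 p q r δ β lam c t < 0 ∧
      fiber p q r δ β lam c₀ t ≤ fiber p q r δ β lam c₀ 1 := by
  have hmax : ∀ᶠ s in 𝓝 (1 : ℝ), fiber p q r δ β lam c₀ s ≤ fiber p q r δ β lam c₀ 1 := by
    have hd : deriv (fiber p q r δ β lam c₀) =ᶠ[𝓝 1] fiberDeriv p q r δ β lam c₀ := by
      filter_upwards [lt_mem_nhds one_pos] with t ht
        using (hasDerivAt_fiber hp hq hr hδ c₀ ht).deriv
    refine isLocalMax_of_deriv_deriv_neg ?_ (hd.eq_of_nhds.trans h0)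
      (hasDerivAt_fiber hp hq hr hδ c₀ one_pos).continuousAt
    rwa [hd.deriv_eq, (hasDerivAt_fiberDeriv c₀ one_pos).deriv]
  obtain ⟨η₀, hη₀, hball⟩ := Metric.eventually_nhds_iff.1 hmax
  have h := exists_local_min_of_perturbation (c₀ := c₀)
    (f := fun c t => -fiber p q r δ β lam c t)
    (f' := fun c t => -fiberDeriv p q r δ β lam c t)
    (f'' := fun c t => -fiberDeriv2 p q r δ β lam c t)
    (fun c _ ht => (hasDerivAt_fiber hp hq hr hδ c ht).neg)
    (fun c _ ht => (hasDerivAt_fiberDeriv c ht).neg)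
    (fun t => (continuous_fiberDeriv t).continuousAt.neg)
    (continuousAt_fiberDeriv2 c₀).neg (by simp [h0]) (by simpa using h1)
  filter_upwards [h, Ioo_mem_nhdsGT hη₀] with η hη hη'
  filter_upwards [hη] with c ⟨t, ht0, ht, h2, h3, _⟩
  exact ⟨t, ht0, ht, by simpa using h2, by simpa using h3,
    hball (by rw [Real.dist_eq]; exact ht.trans hη'.2)⟩

end SingularPQ

namespace SingularPQ

variable {n : ℕ} {Ω : Set (EuclideanSpace ℝ (Fin n))}
  {u w φ : EuclideanSpace ℝ (Fin n) → ℝ} {p q r δ β lam : ℝ}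

/-- The four integrals `(∫ |∇w|^p, ∫ |∇w|^q, ∫ |w|^(1-δ), ∫ |w|^r)` over `Ω` that determine the
fibering map of `w`. -/
noncomputable def coeffs (Ω : Set (EuclideanSpace ℝ (Fin n))) (p q r δ : ℝ)
    (w : EuclideanSpace ℝ (Fin n) → ℝ) : ℝ × ℝ × ℝ × ℝ :=
  (∫ x in Ω, ‖weakGradient Ω w x‖ ^ p, ∫ x in Ω, ‖weakGradient Ω w x‖ ^ q,
    ∫ x in Ω, |w x| ^ (1 - δ), ∫ x in Ω, |w x| ^ r)

theorem MemW1p0.weakGradient_const_mul (hΩ : IsOpen Ω) (hw : MemW1p0 Ω p w) (t : ℝ) :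
    weakGradient Ω (fun x => t * w x) =ᵐ[volume.restrict Ω] fun x => t • weakGradient Ω w x := by
  simpa using hw.weakGradient_linearComb hΩ hw t 0

theorem MemW1p0.const_mul (hΩ : IsOpen Ω) (hp : 1 ≤ p) (hw : MemW1p0 Ω p w) (t : ℝ) :
    MemW1p0 Ω p (fun x => t * w x) := by
  simpa using hw.linearComb hΩ hp hw t 0

theorem MemW1p0.add_smul (hΩ : IsOpen Ω) (hp : 1 ≤ p) (hu : MemW1p0 Ω p u) (hφ : MemW1p0 Ω p φ)
    (ε : ℝ) : MemW1p0 Ω p (fun x => u x + ε * φ x) := by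
  simpa using hu.linearComb hΩ hp hφ 1 ε

theorem MemW1p0.weakGradient_add_smul (hΩ : IsOpen Ω) (hu : MemW1p0 Ω p u)
    (hφ : MemW1p0 Ω p φ) (ε : ℝ) :
    weakGradient Ω (fun x => u x + ε * φ x) =ᵐ[volume.restrict Ω]
      fun x => weakGradient Ω u x + ε • weakGradient Ω φ x := by
  simpa using hu.weakGradient_linearComb hΩ hφ 1 ε

theorem energy_const_mul (hΩ : IsOpen Ω) (hw : MemW1p0 Ω p w) {t : ℝ} (ht : 0 < t) :
    energy Ω p q r δ β lam (fun x => t * w x) = fiber p q r δ β lam (coeffs Ω p q r δ w) t := by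
  have hg : ∀ a : ℝ, ∫ x in Ω, ‖weakGradient Ω (fun x => t * w x) x‖ ^ a
      = t ^ a * ∫ x in Ω, ‖weakGradient Ω w x‖ ^ a := fun a => by
    rw [← integral_const_mul]
    refine integral_congr_ae ?_
    filter_upwards [hw.weakGradient_const_mul hΩ t] with x hx
    rw [hx, norm_smul, Real.norm_of_nonneg ht.le, Real.mul_rpow ht.le (norm_nonneg _)]
  have hf : ∀ a : ℝ, ∫ x in Ω, |t * w x| ^ a = t ^ a * ∫ x in Ω, |w x| ^ a := fun a => by
    rw [← integral_const_mul]
    congr 1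
    ext x
    rw [abs_mul, abs_of_pos ht, Real.mul_rpow ht.le (abs_nonneg _)]
  simp only [energy, fiber, coeffs, hg, hf]

theorem energy_eq_fiber (hΩ : IsOpen Ω) (hw : MemW1p0 Ω p w) :
    energy Ω p q r δ β lam w = fiber p q r δ β lam (coeffs Ω p q r δ w) 1 := by
  simpa using energy_const_mul (q := q) (r := r) (δ := δ) (β := β) (lam := lam) hΩ hw one_pos

theorem deriv_fibering_const_mul (hp : p ≠ 0) (hq : q ≠ 0) (hr : r ≠ 0) (hδ : 1 - δ ≠ 0)
    (hΩ : IsOpen Ω) (hw : MemW1p0 Ω p w) {t : ℝ} (ht : 0 < t) {τ : ℝ} (hτ : 0 < τ) :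
    deriv (fibering Ω p q r δ β lam (fun x => t * w x)) τ =
      t * fiberDeriv p q r δ β lam (coeffs Ω p q r δ w) (τ * t) := by
  have h : fibering Ω p q r δ β lam (fun x => t * w x) =ᶠ[𝓝 τ]
      fun τ => fiber p q r δ β lam (coeffs Ω p q r δ w) (τ * t) := by
    filter_upwards [lt_mem_nhds hτ] with s hs
    rw [fibering, ← energy_const_mul hΩ hw (mul_pos hs ht)]
    simp only [mul_assoc]
  rw [h.deriv_eq]
  have := (hasDerivAt_fiber hp hq hr hδ (β := β) (lam := lam) (coeffs Ω p q r δ w)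
    (mul_pos hτ ht)).comp τ ((hasDerivAt_id τ).mul_const t)
  refine this.deriv.trans ?_
  ring

theorem deriv_deriv_fibering_const_mul (hp : p ≠ 0) (hq : q ≠ 0) (hr : r ≠ 0) (hδ : 1 - δ ≠ 0)
    (hΩ : IsOpen Ω) (hw : MemW1p0 Ω p w) {t : ℝ} (ht : 0 < t) :
    deriv (deriv (fibering Ω p q r δ β lam (fun x => t * w x))) 1 =
      t * (t * fiberDeriv2 p q r δ β lam (coeffs Ω p q r δ w) t) := by
  have h : deriv (fibering Ω p q r δ β lam (fun x => t * w x)) =ᶠ[𝓝 1]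
      fun τ => t * fiberDeriv p q r δ β lam (coeffs Ω p q r δ w) (τ * t) := by
    filter_upwards [lt_mem_nhds one_pos] with s hs
      using deriv_fibering_const_mul hp hq hr hδ hΩ hw ht hs
  rw [h.deriv_eq]
  have ht1 : 0 < id 1 * t := by simpa using ht
  have := ((hasDerivAt_fiberDeriv (p := p) (q := q) (r := r) (δ := δ) (β := β) (lam := lam)
    (coeffs Ω p q r δ w) ht1).comp 1 ((hasDerivAt_id (1 : ℝ)).mul_const t)).const_mul t
  refine this.deriv.trans ?_
  simp only [id, one_mul]
  ring

/-- The standing assumptions on the domain and on the exponents. -/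
structure IsAdmissible (Ω : Set (EuclideanSpace ℝ (Fin n))) (p q r δ : ℝ) : Prop where
  isOpen : IsOpen Ω
  isBounded : Bornology.IsBounded Ω
  one_lt_q : 1 < q
  q_lt_p : q < p
  p_lt_n : p < n
  p_lt_r : p < r
  r_le : r ≤ n * p / (n - p)
  δ_pos : 0 < δ
  δ_lt_one : δ < 1

namespace IsAdmissible

theorem one_lt_p (h : IsAdmissible Ω p q r δ) : 1 < p := h.one_lt_q.trans h.q_lt_p

theorem one_lt_r (h : IsAdmissible Ω p q r δ) : 1 < r := h.one_lt_p.trans h.p_lt_r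

theorem isFiniteMeasure (h : IsAdmissible Ω p q r δ) : IsFiniteMeasure (volume.restrict Ω) :=
  ⟨by simpa using h.isBounded.measure_lt_top⟩

theorem memLp_weakGradient (h : IsAdmissible Ω p q r δ) (hu : MemW1p0 Ω p u) :
    MemLp (weakGradient Ω u) (ENNReal.ofReal q) (volume.restrict Ω) :=
  haveI := h.isFiniteMeasure
  hu.1.2.2.mono_exponent (ENNReal.ofReal_le_ofReal h.q_lt_p.le)

theorem memLp_r (h : IsAdmissible Ω p q r δ) (hu : MemW1p0 Ω p u) :
    MemLp u (ENNReal.ofReal r) (volume.restrict Ω) :=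
  hu.memLp_sobolev h.isBounded h.one_lt_p.le h.p_lt_n (by linarith [h.one_lt_r]) h.r_le

theorem integrable_abs_rpow (h : IsAdmissible Ω p q r δ) (hu : MemW1p0 Ω p u) :
    IntegrableOn (fun x => |u x| ^ (1 - δ)) Ω :=
  haveI := h.isFiniteMeasure
  integrable_norm_rpow_of_memLp (by linarith [h.δ_lt_one]) (hu.1.1.mono_exponent
    (ENNReal.ofReal_le_ofReal (by linarith [h.δ_pos, h.one_lt_p])))

theorem hasDerivAt_gradient_p (h : IsAdmissible Ω p q r δ) (hu : MemW1p0 Ω p u)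
    (hφ : MemW1p0 Ω p φ) :
    IntegrableOn (fun x => ‖weakGradient Ω u x‖ ^ (p - 2) *
      inner ℝ (weakGradient Ω u x) (weakGradient Ω φ x)) Ω ∧
    HasDerivAt (fun ε : ℝ => (coeffs Ω p q r δ (fun x => u x + ε * φ x)).1)
      (p * ∫ x in Ω, ‖weakGradient Ω u x‖ ^ (p - 2) *
        inner ℝ (weakGradient Ω u x) (weakGradient Ω φ x)) 0 := by
  have := hasDerivAt_integral_norm_add_smul_rpow h.one_lt_p hu.1.2.2 hφ.1.2.2
  refine ⟨this.1, this.2.congr_of_eventuallyEq (Eventually.of_forall fun ε => ?_)⟩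
  refine integral_congr_ae ?_
  filter_upwards [hu.weakGradient_add_smul h.isOpen hφ ε] with x hx using by rw [hx]

theorem hasDerivAt_gradient_q (h : IsAdmissible Ω p q r δ) (hu : MemW1p0 Ω p u)
    (hφ : MemW1p0 Ω p φ) :
    IntegrableOn (fun x => ‖weakGradient Ω u x‖ ^ (q - 2) *
      inner ℝ (weakGradient Ω u x) (weakGradient Ω φ x)) Ω ∧
    HasDerivAt (fun ε : ℝ => (coeffs Ω p q r δ (fun x => u x + ε * φ x)).2.1)
      (q * ∫ x in Ω, ‖weakGradient Ω u x‖ ^ (q - 2) *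
        inner ℝ (weakGradient Ω u x) (weakGradient Ω φ x)) 0 := by
  have := hasDerivAt_integral_norm_add_smul_rpow h.one_lt_q (h.memLp_weakGradient hu)
    (h.memLp_weakGradient hφ)
  refine ⟨this.1, this.2.congr_of_eventuallyEq (Eventually.of_forall fun ε => ?_)⟩
  refine integral_congr_ae ?_
  filter_upwards [hu.weakGradient_add_smul h.isOpen hφ ε] with x hx using by rw [hx]

theorem hasDerivAt_rpow_r (h : IsAdmissible Ω p q r δ) (hu : MemW1p0 Ω p u)
    (hφ : MemW1p0 Ω p φ) :
    IntegrableOn (fun x => |u x| ^ (r - 2) * (φ x * u x)) Ω ∧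
    HasDerivAt (fun ε : ℝ => (coeffs Ω p q r δ (fun x => u x + ε * φ x)).2.2.2)
      (r * ∫ x in Ω, |u x| ^ (r - 2) * (φ x * u x)) 0 :=
  hasDerivAt_integral_norm_add_smul_rpow h.one_lt_r (h.memLp_r hu) (h.memLp_r hφ)

theorem tendsto_integral_abs_rpow (h : IsAdmissible Ω p q r δ) (hu : MemW1p0 Ω p u)
    (hφ : MemW1p0 Ω p φ) :
    Tendsto (fun ε : ℝ => (coeffs Ω p q r δ (fun x => u x + ε * φ x)).2.2.1) (𝓝 0)
      (𝓝 (coeffs Ω p q r δ u).2.2.1) := by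
  have hδ : 0 < 1 - δ := by linarith [h.δ_lt_one]
  refine tendsto_iff_dist_tendsto_zero.2 ?_
  have hlim : Tendsto (fun ε : ℝ => |ε| ^ (1 - δ) * ∫ x in Ω, |φ x| ^ (1 - δ)) (𝓝 0) (𝓝 0) := by
    have : Continuous fun ε : ℝ => |ε| ^ (1 - δ) * ∫ x in Ω, |φ x| ^ (1 - δ) :=
      (continuous_abs.rpow_const fun _ => Or.inr hδ.le).mul continuous_const
    simpa [Real.zero_rpow hδ.ne'] using this.tendsto 0
  refine squeeze_zero (fun _ => dist_nonneg) (fun ε => ?_) hlim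
  have i1 := h.integrable_abs_rpow (hu.add_smul h.isOpen h.one_lt_p.le hφ ε)
  have i2 := h.integrable_abs_rpow hu
  have i3 := h.integrable_abs_rpow hφ
  simp only [coeffs]
  rw [Real.dist_eq, ← integral_sub i1 i2, ← integral_const_mul]
  refine abs_integral_le_integral_abs.trans (integral_mono (i1.sub i2).abs (i3.const_mul _) ?_)
  intro x
  refine (abs_abs_add_rpow_sub_le hδ.le (by linarith [h.δ_pos])).trans (le_of_eq ?_)
  rw [abs_mul, Real.mul_rpow (abs_nonneg _) (abs_nonneg _)]

theorem tendsto_coeffs (h : IsAdmissible Ω p q r δ) (hu : MemW1p0 Ω p u)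
    (hφ : MemW1p0 Ω p φ) :
    Tendsto (fun ε : ℝ => coeffs Ω p q r δ (fun x => u x + ε * φ x)) (𝓝 0)
      (𝓝 (coeffs Ω p q r δ u)) := by
  have h1 := (h.hasDerivAt_gradient_p hu hφ).2.continuousAt.tendsto
  have h2 := (h.hasDerivAt_gradient_q hu hφ).2.continuousAt.tendsto
  have h3 := h.tendsto_integral_abs_rpow hu hφ
  have h4 := (h.hasDerivAt_rpow_r hu hφ).2.continuousAt.tendsto
  simp only [zero_mul, add_zero] at h1 h2 h4
  exact h1.prodMk_nhds (h2.prodMk_nhds (h3.prodMk_nhds h4))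

/-! ### Variations along the Nehari manifold -/

theorem coeffs_ne_zero (h : IsAdmissible Ω p q r δ) (hu : MemW1p0 Ω p u)
    (hu0 : ¬ ∀ᵐ x ∂(volume.restrict Ω), u x = 0) : (coeffs Ω p q r δ u).2.2.1 ≠ 0 := by
  intro h0
  have hδ : 1 - δ ≠ 0 := by linarith [h.δ_lt_one]
  rw [coeffs, integral_eq_zero_iff_of_nonneg (fun x => by positivity)
    (h.integrable_abs_rpow hu)] at h0
  refine hu0 ?_
  filter_upwards [h0] with x hx
  simpa [Real.rpow_eq_zero (abs_nonneg _) hδ] using hx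

theorem not_ae_zero_of_coeffs (h : IsAdmissible Ω p q r δ)
    (hw : (coeffs Ω p q r δ w).2.2.1 ≠ 0) : ¬ ∀ᵐ x ∂(volume.restrict Ω), w x = 0 := by
  intro h0
  have hδ : 1 - δ ≠ 0 := by linarith [h.δ_lt_one]
  refine hw ((integral_congr_ae ?_).trans (integral_zero _ _))
  filter_upwards [h0] with x hx
  simp [hx, Real.zero_rpow hδ]

theorem const_mul_mem_nehari (h : IsAdmissible Ω p q r δ) (hw : MemW1p0 Ω p w)
    (hw0 : ¬ ∀ᵐ x ∂(volume.restrict Ω), w x = 0) {t : ℝ} (ht : 0 < t)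
    (hd : fiberDeriv p q r δ β lam (coeffs Ω p q r δ w) t = 0) :
    (fun x => t * w x) ∈ nehari Ω p q r δ β lam := by
  refine ⟨hw.const_mul h.isOpen h.one_lt_p.le t, fun h0 => hw0 ?_, ?_⟩
  · filter_upwards [h0] with x hx
    exact (mul_eq_zero.1 hx).resolve_left ht.ne'
  · rw [deriv_fibering_const_mul (by linarith [h.one_lt_p]) (by linarith [h.one_lt_q])
      (by linarith [h.one_lt_r]) (by linarith [h.δ_lt_one]) h.isOpen hw ht one_pos, one_mul, hd,
      mul_zero]

theorem deriv_deriv_fibering (h : IsAdmissible Ω p q r δ) (hw : MemW1p0 Ω p w) {t : ℝ}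
    (ht : 0 < t) :
    deriv (deriv (fibering Ω p q r δ β lam (fun x => t * w x))) 1 =
      t * (t * fiberDeriv2 p q r δ β lam (coeffs Ω p q r δ w) t) :=
  deriv_deriv_fibering_const_mul (by linarith [h.one_lt_p]) (by linarith [h.one_lt_q])
      (by linarith [h.one_lt_r]) (by linarith [h.δ_lt_one]) h.isOpen hw ht

theorem fiberDeriv_eq_zero (h : IsAdmissible Ω p q r δ) (hu : u ∈ nehari Ω p q r δ β lam) :
    fiberDeriv p q r δ β lam (coeffs Ω p q r δ u) 1 = 0 := by
  have := deriv_fibering_const_mul (β := β) (lam := lam) (by linarith [h.one_lt_p])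
    (by linarith [h.one_lt_q])
    (by linarith [h.one_lt_r]) (by linarith [h.δ_lt_one]) h.isOpen hu.1 one_pos one_pos
  simp only [one_mul] at this
  rw [← this]
  exact hu.2.2

theorem fiberDeriv2_eq (h : IsAdmissible Ω p q r δ) (hu : MemW1p0 Ω p u) :
    fiberDeriv2 p q r δ β lam (coeffs Ω p q r δ u) 1 =
      deriv (deriv (fibering Ω p q r δ β lam u)) 1 := by
  have := h.deriv_deriv_fibering (β := β) (lam := lam) hu one_pos
  simp only [one_mul] at this
  exact this.symm

end IsAdmissible

/-- `u` is minimal in the direction `φ` up to rescaling: `I(s u) ≤ I(s (u + ε φ))` along some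
sequences `ε → 0+` and `s → 1`. The energies are written through the fibering maps. -/
def IsDirectionalMin (Ω : Set (EuclideanSpace ℝ (Fin n))) (p q r δ β lam : ℝ)
    (u φ : EuclideanSpace ℝ (Fin n) → ℝ) : Prop :=
  ∃ ε s : ℕ → ℝ, (∀ k, 0 < ε k) ∧ Tendsto ε atTop (𝓝 0) ∧ (∀ k, 0 < s k) ∧
    Tendsto s atTop (𝓝 1) ∧ ∀ k, fiber p q r δ β lam (coeffs Ω p q r δ u) (s k) ≤
      fiber p q r δ β lam (coeffs Ω p q r δ (fun x => u x + ε k * φ x)) (s k)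

theorem isDirectionalMin_of_eventually
    (H : ∀ᶠ η in 𝓝[>] (0 : ℝ), ∀ᶠ ε in 𝓝[>] (0 : ℝ), ∃ s, 0 < s ∧ |s - 1| < η ∧
      fiber p q r δ β lam (coeffs Ω p q r δ u) s ≤
        fiber p q r δ β lam (coeffs Ω p q r δ (fun x => u x + ε * φ x)) s) :
    IsDirectionalMin Ω p q r δ β lam u φ := by
  have hk : ∀ k : ℕ, ∃ ε s : ℝ, 0 < ε ∧ ε < 1 / ((k : ℝ) + 1) ∧ 0 < s ∧
      |s - 1| < 1 / ((k : ℝ) + 1) ∧ fiber p q r δ β lam (coeffs Ω p q r δ u) s ≤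
        fiber p q r δ β lam (coeffs Ω p q r δ (fun x => u x + ε * φ x)) s := fun k => by
    have hk0 : (0 : ℝ) < 1 / ((k : ℝ) + 1) := Nat.one_div_pos_of_nat
    obtain ⟨η, hη, hη'⟩ := (H.and (Ioo_mem_nhdsGT hk0)).exists
    obtain ⟨ε, ⟨s, hs0, hs, hle⟩, hε⟩ := (hη.and (Ioo_mem_nhdsGT hk0)).exists
    exact ⟨ε, s, hε.1, hε.2, hs0, hs.trans hη'.2, hle⟩
  choose ε s h1 h2 h3 h4 h5 using hk
  have hlim := tendsto_one_div_add_atTop_nhds_zero_nat (𝕜 := ℝ)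
  refine ⟨ε, s, h1, squeeze_zero (fun k => (h1 k).le) (fun k => (h2 k).le) hlim, h3, ?_, h5⟩
  refine tendsto_iff_dist_tendsto_zero.2 (squeeze_zero (fun _ => dist_nonneg)
    (fun k => ?_) hlim)
  rw [Real.dist_eq]
  exact (h4 k).le

theorem IsAdmissible.isDirectionalMin_of_nehariPlus (h : IsAdmissible Ω p q r δ)
    (hu : u ∈ nehariPlus Ω p q r δ β lam)
    (hmin : ∀ w ∈ nehariPlus Ω p q r δ β lam,
      energy Ω p q r δ β lam u ≤ energy Ω p q r δ β lam w)
    (hφ : MemW1p0 Ω p φ) : IsDirectionalMin Ω p q r δ β lam u φ := by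
  have hu1 := hu.1.1
  refine isDirectionalMin_of_eventually ?_
  have hpert := fiber_isMin_of_perturbation (by linarith [h.one_lt_p])
    (by linarith [h.one_lt_q]) (by linarith [h.one_lt_r]) (by linarith [h.δ_lt_one])
    (h.fiberDeriv_eq_zero hu.1) ((h.fiberDeriv2_eq hu1).symm ▸ hu.2)
  have hlim := (h.tendsto_coeffs hu1 hφ).mono_left (nhdsWithin_le_nhds (s := Ioi 0))
  filter_upwards [hpert, self_mem_nhdsWithin] with η hη hη0
  filter_upwards [hlim.eventually hη,
    (h.tendsto_integral_abs_rpow hu1 hφ).mono_left (nhdsWithin_le_nhds (s := Ioi 0))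
      (eventually_ne_nhds (h.coeffs_ne_zero hu1 hu.1.2.1))] with ε ⟨t, ht0, ht, h1, h2, h3⟩ hne
  have hw := hu1.add_smul h.isOpen h.one_lt_p.le hφ ε
  have hmem := h.const_mul_mem_nehari hw (h.not_ae_zero_of_coeffs hne) ht0 h1
  -- After projecting `u + ε φ` to `N⁺` by a factor `t`, minimality of its fibering map at `t`
  -- allows going back to `u + ε φ` itself.
  refine ⟨1, one_pos, by simpa using hη0, ?_⟩
  rw [← energy_eq_fiber h.isOpen hu1]
  refine (hmin _ ⟨hmem, ?_⟩).trans ?_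
  · rw [h.deriv_deriv_fibering hw ht0]
    positivity
  · rw [energy_const_mul h.isOpen hw ht0]
    exact h3 1 (by simpa using hη0)

theorem IsAdmissible.isDirectionalMin_of_nehariMinus (h : IsAdmissible Ω p q r δ)
    (hu : u ∈ nehariMinus Ω p q r δ β lam)
    (hmin : ∀ w ∈ nehariMinus Ω p q r δ β lam,
      energy Ω p q r δ β lam u ≤ energy Ω p q r δ β lam w)
    (hφ : MemW1p0 Ω p φ) : IsDirectionalMin Ω p q r δ β lam u φ := by
  have hu1 := hu.1.1
  refine isDirectionalMin_of_eventually ?_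
  have hpert := fiber_critical_of_perturbation_of_neg (by linarith [h.one_lt_p])
    (by linarith [h.one_lt_q]) (by linarith [h.one_lt_r]) (by linarith [h.δ_lt_one])
    (h.fiberDeriv_eq_zero hu.1) ((h.fiberDeriv2_eq hu1).symm ▸ hu.2)
  have hlim := (h.tendsto_coeffs hu1 hφ).mono_left (nhdsWithin_le_nhds (s := Ioi 0))
  filter_upwards [hpert] with η hη
  filter_upwards [hlim.eventually hη,
    (h.tendsto_integral_abs_rpow hu1 hφ).mono_left (nhdsWithin_le_nhds (s := Ioi 0))
      (eventually_ne_nhds (h.coeffs_ne_zero hu1 hu.1.2.1))] with ε ⟨t, ht0, ht, h1, h2, h3⟩ hne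
  have hw := hu1.add_smul h.isOpen h.one_lt_p.le hφ ε
  have hmem := h.const_mul_mem_nehari hw (h.not_ae_zero_of_coeffs hne) ht0 h1
  -- Here the fibering map of `u` has a local maximum at `1`, so that `I(t u) ≤ I(u)`.
  refine ⟨t, ht0, ht, h3.trans ?_⟩
  rw [← energy_eq_fiber h.isOpen hu1, ← energy_const_mul h.isOpen hw ht0]
  refine hmin _ ⟨hmem, ?_⟩
  rw [h.deriv_deriv_fibering hw ht0]
  exact mul_neg_of_pos_of_neg ht0 (mul_neg_of_pos_of_neg ht0 h2)

end SingularPQ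

namespace SingularPQ

variable {n : ℕ} {Ω : Set (EuclideanSpace ℝ (Fin n))}
  {u φ : EuclideanSpace ℝ (Fin n) → ℝ} {p q r δ β lam : ℝ}

/-! ### The first variation and the singular term -/

/-- The derivative at `u`, in the direction `φ`, of the energy without its singular term. -/
noncomputable def regularVariation (Ω : Set (EuclideanSpace ℝ (Fin n))) (p q r β : ℝ)
    (u φ : EuclideanSpace ℝ (Fin n) → ℝ) : ℝ :=
  (∫ x in Ω, ‖weakGradient Ω u x‖ ^ (p - 2) * inner ℝ (weakGradient Ω u x) (weakGradient Ω φ x))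
  + β * (∫ x in Ω, ‖weakGradient Ω u x‖ ^ (q - 2) *
      inner ℝ (weakGradient Ω u x) (weakGradient Ω φ x))
  - ∫ x in Ω, |u x| ^ (r - 2) * (φ x * u x)

namespace IsAdmissible

/-- Along the sequences of a directional minimum, the difference quotients of the singular term are
controlled by quantities converging to the variation of the regular part. -/
theorem exists_quotient_le (h : IsAdmissible Ω p q r δ) (hu : MemW1p0 Ω p u)
    (hφ : MemW1p0 Ω p φ) (hmin : IsDirectionalMin Ω p q r δ β lam u φ) :
    ∃ ε K : ℕ → ℝ, (∀ k, 0 < ε k) ∧ Tendsto ε atTop (𝓝 0) ∧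
      Tendsto K atTop (𝓝 (regularVariation Ω p q r β u φ)) ∧
      ∀ k, lam / (1 - δ) * ((ε k)⁻¹ * ((coeffs Ω p q r δ (fun x => u x + ε k * φ x)).2.2.1 -
        (coeffs Ω p q r δ u).2.2.1)) ≤ K k := by
  obtain ⟨ε, s, hε, hε0, hs, hs1, hle⟩ := hmin
  have hp0 : p ≠ 0 := by linarith [h.one_lt_p]
  have hq0 : q ≠ 0 := by linarith [h.one_lt_q]
  have hr0 : r ≠ 0 := by linarith [h.one_lt_r]
  have hεn : Tendsto ε atTop (𝓝[≠] 0) :=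
    tendsto_nhdsWithin_iff.2 ⟨hε0, Eventually.of_forall fun k => (hε k).ne'⟩
  have hA := (h.hasDerivAt_gradient_p hu hφ).2.tendsto_slope_zero.comp hεn
  have hB := (h.hasDerivAt_gradient_q hu hφ).2.tendsto_slope_zero.comp hεn
  have hD := (h.hasDerivAt_rpow_r hu hφ).2.tendsto_slope_zero.comp hεn
  simp only [Function.comp_def, zero_add, zero_mul, add_zero, smul_eq_mul] at hA hB hD
  have hpow : ∀ a : ℝ, Tendsto (fun k => s k ^ a) atTop (𝓝 1) := fun a => by
    simpa using hs1.rpow_const (p := a) (Or.inl one_ne_zero)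
  set c₀ := coeffs Ω p q r δ u with hc₀
  refine ⟨ε, fun k => (s k ^ (1 - δ))⁻¹ *
    (1 / p * (s k ^ p * ((ε k)⁻¹ * ((coeffs Ω p q r δ (fun x => u x + ε k * φ x)).1 - c₀.1)))
    + β * (1 / q) * (s k ^ q *
      ((ε k)⁻¹ * ((coeffs Ω p q r δ (fun x => u x + ε k * φ x)).2.1 - c₀.2.1)))
    - 1 / r * (s k ^ r *
      ((ε k)⁻¹ * ((coeffs Ω p q r δ (fun x => u x + ε k * φ x)).2.2.2 - c₀.2.2.2)))),
    hε, hε0, ?_, fun k => ?_⟩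
  · have := ((hpow (1 - δ)).inv₀ one_ne_zero).mul
      (((((hpow p).mul hA).const_mul (1 / p)).add
      (((hpow q).mul hB).const_mul (β * (1 / q)))).sub (((hpow r).mul hD).const_mul (1 / r)))
    convert this using 2
    rw [regularVariation]
    field_simp
  · have hsp : 0 < s k ^ (1 - δ) := Real.rpow_pos_of_pos (hs k) _
    have key := mul_le_mul_of_nonneg_left (hle k) (inv_pos.2 (hε k)).le
    simp only [fiber] at key
    rw [le_inv_mul_iff₀ hsp]
    linear_combination key

/-- The singular integral against a nonnegative direction is bounded, by Fatou's lemma. The powers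
are taken in `ℝ≥0∞`, so that `0 ^ (-δ) = ∞`; nothing is assumed on the zero set of `u`. -/
theorem lintegral_singular_le (h : IsAdmissible Ω p q r δ) (hlam : 0 < lam)
    (hu : MemW1p0 Ω p u) (hu0 : ∀ᵐ x ∂(volume.restrict Ω), 0 ≤ u x)
    (hφ : MemW1p0 Ω p φ) (hφ0 : ∀ᵐ x ∂(volume.restrict Ω), 0 ≤ φ x)
    (hmin : IsDirectionalMin Ω p q r δ β lam u φ) :
    ∫⁻ x in Ω, ENNReal.ofReal (u x) ^ (-δ) * ENNReal.ofReal (φ x) ≤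
      ENNReal.ofReal (regularVariation Ω p q r β u φ / lam) := by
  obtain ⟨ε, K, hε, hε0, hK, hle⟩ := h.exists_quotient_le hu hφ hmin
  have hδ : 0 < 1 - δ := by linarith [h.δ_lt_one]
  have hδ1 : 1 - δ ≤ 1 := by linarith [h.δ_pos]
  have hum := hu.1.1.1.aemeasurable
  have hφm := hφ.1.1.1.aemeasurable
  set f : ℕ → EuclideanSpace ℝ (Fin n) → ℝ≥0∞ := fun k x =>
    ENNReal.ofReal (u x + ε k * φ x) ^ (-δ) * ENNReal.ofReal (φ x) with hf
  have hfm : ∀ k, AEMeasurable (f k) (volume.restrict Ω) := fun k =>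
    ((hum.add (hφm.const_mul _)).ennreal_ofReal.pow_const _).mul hφm.ennreal_ofReal
  have hlim : ∀ᵐ x ∂(volume.restrict Ω), Tendsto (fun k => f k x) atTop
      (𝓝 (ENNReal.ofReal (u x) ^ (-δ) * ENNReal.ofReal (φ x))) := by
    refine ae_of_all _ fun x => ENNReal.Tendsto.mul_const ?_ (Or.inr ENNReal.ofReal_ne_top)
    refine (ENNReal.continuous_rpow_const.tendsto _).comp (ENNReal.tendsto_ofReal ?_)
    simpa using (hε0.mul_const (φ x)).const_add (u x)
  have hint : ∀ k, ∫⁻ x in Ω, f k x ≤ ENNReal.ofReal (K k / lam) := fun k => by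
    have i1 := h.integrable_abs_rpow (hu.add_smul h.isOpen h.one_lt_p.le hφ (ε k))
    have i2 := h.integrable_abs_rpow hu
    set g : EuclideanSpace ℝ (Fin n) → ℝ := fun x =>
      (1 - δ)⁻¹ * ((ε k)⁻¹ * (|u x + ε k * φ x| ^ (1 - δ) - |u x| ^ (1 - δ))) with hg
    have hgi : IntegrableOn g Ω := ((i1.sub i2).const_mul _).const_mul _
    have hg0 : 0 ≤ᵐ[volume.restrict Ω] g := by
      filter_upwards [hu0, hφ0] with x hx hx'
      have hεφ : 0 ≤ ε k * φ x := mul_nonneg (hε k).le hx'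
      have h1 : |u x| ^ (1 - δ) ≤ |u x + ε k * φ x| ^ (1 - δ) := by
        rw [abs_of_nonneg hx, abs_of_nonneg (by linarith)]
        gcongr
        linarith
      exact mul_nonneg (inv_nonneg.2 hδ.le) (mul_nonneg (inv_nonneg.2 (hε k).le) (by linarith))
    calc ∫⁻ x in Ω, f k x ≤ ∫⁻ x in Ω, ENNReal.ofReal (g x) := by
          refine lintegral_mono_ae ?_
          filter_upwards [hu0, hφ0] with x hx hx'
          -- Where `φ` vanishes so does `f k`, even if the singular factor is infinite.
          rcases hx'.eq_or_lt with h0 | h0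
          · simp [hf, ← h0]
          have hpos : 0 < u x + ε k * φ x := by
            have := mul_pos (hε k) h0
            linarith
          simp only [hf, hg]
          rw [ENNReal.ofReal_rpow_of_pos hpos, ← ENNReal.ofReal_mul (by positivity)]
          refine ENNReal.ofReal_le_ofReal ?_
          have key := mul_rpow_sub_one_mul_le hx hpos hδ.le hδ1
          rw [show 1 - δ - 1 = -δ by ring] at key
          rw [abs_of_nonneg hx, abs_of_pos hpos, le_inv_mul_iff₀ hδ, le_inv_mul_iff₀ (hε k)]
          linarith
      _ = ENNReal.ofReal (∫ x in Ω, g x) := (ofReal_integral_eq_lintegral_ofReal hgi hg0).symm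
      _ ≤ ENNReal.ofReal (K k / lam) := by
          refine ENNReal.ofReal_le_ofReal ?_
          rw [le_div_iff₀ hlam]
          refine le_trans (le_of_eq ?_) (hle k)
          simp only [hg, coeffs]
          rw [integral_const_mul, integral_const_mul, integral_sub i1 i2]
          ring
  calc ∫⁻ x in Ω, ENNReal.ofReal (u x) ^ (-δ) * ENNReal.ofReal (φ x)
      = ∫⁻ x in Ω, liminf (fun k => f k x) atTop := by
        refine lintegral_congr_ae ?_
        filter_upwards [hlim] with x hx using hx.liminf_eq.symm
    _ ≤ liminf (fun k => ∫⁻ x in Ω, f k x) atTop := lintegral_liminf_le' hfm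
    _ ≤ liminf (fun k => ENNReal.ofReal (K k / lam)) atTop :=
        liminf_le_liminf (Eventually.of_forall hint)
    _ = ENNReal.ofReal (regularVariation Ω p q r β u φ / lam) :=
        (ENNReal.tendsto_ofReal (hK.div_const lam)).liminf_eq

/-- Positivity of a minimizer: no maximum principle is needed, as the singular integral
`∫ u^(-δ) φ` is finite for every nonnegative test function `φ`. -/
theorem ae_pos (h : IsAdmissible Ω p q r δ) (hlam : 0 < lam)
    (hu : MemW1p0 Ω p u) (hu0 : ∀ᵐ x ∂(volume.restrict Ω), 0 ≤ u x)
    (hmin : ∀ φ, MemW1p0 Ω p φ → IsDirectionalMin Ω p q r δ β lam u φ) :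
    ∀ᵐ x ∂(volume.restrict Ω), 0 < u x := by
  rw [ae_restrict_iff' h.isOpen.measurableSet]
  refine measure_null_of_locally_null _ fun x hx => ?_
  have hxΩ : x ∈ Ω := by
    by_contra hx'
    exact hx fun h' => absurd h' hx'
  obtain ⟨f, hfs, hfc, hfd, hfr, hfx⟩ :=
    exists_contDiff_tsupport_subset (n := ⊤) (h.isOpen.mem_nhds hxΩ)
  have hf0 : ∀ y, 0 ≤ f y := fun y => (hfr (mem_range_self y)).1
  have hft : IsTestFunction Ω f := ⟨hfd, hfc, hfs⟩
  have hle := h.lintegral_singular_le hlam hu hu0 (hft.memW1p0 h.isOpen) (ae_of_all _ hf0)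
    (hmin f (hft.memW1p0 h.isOpen))
  have hfin := ae_lt_top' (μ := volume.restrict Ω)
    ((hu.1.1.1.aemeasurable.ennreal_ofReal.pow_const (-δ)).mul
      hfd.continuous.measurable.aemeasurable.ennreal_ofReal)
    (hle.trans_lt ENNReal.ofReal_lt_top).ne
  rw [ae_restrict_iff' h.isOpen.measurableSet] at hfin
  refine ⟨_, inter_mem_nhdsWithin _ ((hfd.continuous.isOpen_preimage _ isOpen_Ioi).mem_nhds
    (show x ∈ f ⁻¹' Ioi 0 by simp [hfx])), measure_mono_null ?_ hfin⟩
  rintro y ⟨hy, hfy⟩ hy'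
  refine hy fun hyΩ => ?_
  by_contra hneg
  have := hy' hyΩ
  rw [Pi.mul_apply, ENNReal.ofReal_of_nonpos (not_lt.1 hneg),
    ENNReal.zero_rpow_of_neg (by linarith [h.δ_pos]), ENNReal.top_mul
    (by simpa using hfy)] at this
  exact lt_irrefl _ this

end IsAdmissible

/-! ### Integrability of the singular term for general directions -/

/-- The smooth regularization `√(φ² + η²) - η` of `|φ|`. -/
noncomputable def smoothAbs (η : ℝ) (φ : EuclideanSpace ℝ (Fin n) → ℝ)
    (x : EuclideanSpace ℝ (Fin n)) : ℝ :=
  √(φ x ^ 2 + η ^ 2) - η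

theorem IsTestFunction.smoothAbs {η : ℝ} (hη : 0 < η) (hφ : IsTestFunction Ω φ) :
    IsTestFunction Ω (smoothAbs η φ) := by
  have hsub : Function.support (SingularPQ.smoothAbs η φ) ⊆ Function.support φ := fun x hx h0 =>
    hx (by simp [SingularPQ.smoothAbs, h0, Real.sqrt_sq hη.le])
  refine ⟨(((hφ.1.pow 2).add contDiff_const).sqrt fun x => by positivity).sub contDiff_const,
    hφ.2.1.mono hsub, (closure_mono hsub).trans hφ.2.2⟩

theorem smoothAbs_nonneg (η : ℝ) (x : EuclideanSpace ℝ (Fin n)) :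
    0 ≤ smoothAbs η φ x :=
  sub_nonneg.2 (Real.le_sqrt_of_sq_le (by nlinarith [sq_nonneg (φ x)]))

theorem abs_smoothAbs_sub_abs_le {η : ℝ} (hη : 0 < η) (x : EuclideanSpace ℝ (Fin n)) :
    |smoothAbs η φ x - (|φ x|)| ≤ η := by
  have h1 : |φ x| ≤ √(φ x ^ 2 + η ^ 2) := Real.abs_le_sqrt (by nlinarith [sq_nonneg η])
  have h2 : √(φ x ^ 2 + η ^ 2) ≤ |φ x| + η := by
    refine Real.sqrt_le_iff.2 ⟨by positivity, ?_⟩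
    nlinarith [sq_abs (φ x), mul_nonneg (abs_nonneg (φ x)) hη.le]
  rw [abs_le, smoothAbs]
  constructor <;> linarith

theorem IsTestFunction.norm_gradient_smoothAbs_le {η : ℝ} (hη : 0 < η) (hφ : IsTestFunction Ω φ)
    (x : EuclideanSpace ℝ (Fin n)) :
    ‖gradient (SingularPQ.smoothAbs η φ) x‖ ≤ ‖gradient φ x‖ := by
  rw [norm_gradient_eq, norm_gradient_eq]
  have hd := (hφ.1.differentiable (by simp) x).hasFDerivAt
  have hpos : 0 < φ x ^ 2 + η ^ 2 := by positivity
  have h1 := ((((hd.pow 2).add_const (η ^ 2)).sqrt hpos.ne').sub_const η)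
  have h2 : fderiv ℝ (SingularPQ.smoothAbs η φ) x =
      (φ x / √(φ x ^ 2 + η ^ 2)) • fderiv ℝ φ x := by
    refine h1.fderiv.trans ?_
    ext v
    simp
    field_simp
  have h3 : |φ x| ≤ √(φ x ^ 2 + η ^ 2) := Real.abs_le_sqrt (by nlinarith [sq_nonneg η])
  rw [h2, norm_smul, Real.norm_eq_abs, abs_div, abs_of_nonneg (Real.sqrt_nonneg _)]
  exact mul_le_of_le_one_left (norm_nonneg _) (div_le_one_of_le₀ h3 (Real.sqrt_nonneg _))

end SingularPQ

namespace SingularPQ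

variable {n : ℕ} {Ω : Set (EuclideanSpace ℝ (Fin n))}
  {u φ : EuclideanSpace ℝ (Fin n) → ℝ} {p q r δ β lam : ℝ}

theorem integral_norm_rpow_mul_inner_le {α E : Type*} {m : MeasurableSpace α} {μ : Measure α}
    [NormedAddCommGroup E] [InnerProductSpace ℝ E] {G H : α → E} (hp : 1 < p)
    (hG : MemLp G (ENNReal.ofReal p) μ) (hH : MemLp H (ENNReal.ofReal p) μ) :
    ∫ x, ‖G x‖ ^ (p - 2) * inner ℝ (G x) (H x) ∂μ ≤ ∫ x, ‖G x‖ ^ p ∂μ + ∫ x, ‖H x‖ ^ p ∂μ := by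
  have i1 := integrable_norm_rpow_of_memLp (by linarith) hG
  have i2 := integrable_norm_rpow_of_memLp (by linarith) hH
  rw [← integral_add i1 i2]
  refine integral_mono (hasDerivAt_integral_norm_add_smul_rpow hp hG hH).1 (i1.add i2) fun x => ?_
  exact (le_abs_self _).trans ((abs_norm_rpow_mul_inner_le _ _ p).trans
    (rpow_sub_one_mul_le (norm_nonneg _) (norm_nonneg _) hp))

theorem integral_norm_rpow_le_of_eLpNorm_le {α E : Type*} {m : MeasurableSpace α} {μ : Measure α}
    [NormedAddCommGroup E] {G : α → E} (hp : 0 < p) (hG : MemLp G (ENNReal.ofReal p) μ)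
    {M : ℝ≥0∞} (hM : M ≠ ⊤) (hle : eLpNorm G (ENNReal.ofReal p) μ ≤ M) :
    ∫ x, ‖G x‖ ^ p ∂μ ≤ M.toReal ^ p := by
  have h0 : 0 ≤ ∫ x, ‖G x‖ ^ p ∂μ := integral_nonneg fun x => by positivity
  have h := hG.eLpNorm_eq_integral_rpow_norm (by simpa using hp) (by simp)
  rw [ENNReal.toReal_ofReal hp.le] at h
  rw [h, ENNReal.ofReal_le_iff_le_toReal hM] at hle
  have h2 := Real.rpow_le_rpow (by positivity) hle hp.le
  rwa [Real.rpow_inv_rpow h0 hp.ne'] at h2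

namespace IsAdmissible

/-- A bound, uniform on bounded subsets of `W^{1,p}_0(Ω)`, for `regularVariation` in nonnegative
directions. -/
theorem regularVariation_le (h : IsAdmissible Ω p q r δ) (hβ : 0 < β)
    (hu : MemW1p0 Ω p u) (hu0 : ∀ᵐ x ∂(volume.restrict Ω), 0 ≤ u x)
    (hφ : MemW1p0 Ω p φ) (hφ0 : ∀ᵐ x ∂(volume.restrict Ω), 0 ≤ φ x)
    {M : ℝ≥0∞} (hM : M ≠ ⊤)
    (hle : eLpNorm (weakGradient Ω φ) (ENNReal.ofReal p) (volume.restrict Ω) ≤ M) :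
    regularVariation Ω p q r β u φ ≤
      (∫ x in Ω, ‖weakGradient Ω u x‖ ^ p) + M.toReal ^ p +
      β * ((∫ x in Ω, ‖weakGradient Ω u x‖ ^ q) + ((volume.restrict Ω).real univ + M.toReal ^ p))
      := by
  have := h.isFiniteMeasure
  have hp := h.one_lt_p
  have h1 := integral_norm_rpow_mul_inner_le hp hu.1.2.2 hφ.1.2.2
  have h2 := integral_norm_rpow_mul_inner_le h.one_lt_q (h.memLp_weakGradient hu)
    (h.memLp_weakGradient hφ)
  have h3 := integral_norm_rpow_le_of_eLpNorm_le (by linarith) hφ.1.2.2 hM hle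
  have iq := integrable_norm_rpow_of_memLp (by linarith [h.one_lt_q]) (h.memLp_weakGradient hφ)
  have ip := integrable_norm_rpow_of_memLp (by linarith) hφ.1.2.2
  have h4 : ∫ x in Ω, ‖weakGradient Ω φ x‖ ^ q ≤
      (volume.restrict Ω).real univ + ∫ x in Ω, ‖weakGradient Ω φ x‖ ^ p := by
    have e : (volume.restrict Ω).real univ = ∫ x in Ω, (1 : ℝ) := by simp
    rw [e, ← integral_add (integrable_const _) ip]
    refine integral_mono iq ((integrable_const _).add ip) fun x => ?_
    have hn := norm_nonneg (weakGradient Ω φ x)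
    rcases le_total ‖weakGradient Ω φ x‖ 1 with h' | h'
    · have := Real.rpow_le_one hn h' (by linarith [h.one_lt_q] : (0 : ℝ) ≤ q)
      have := Real.rpow_nonneg hn p
      linarith
    · have := Real.rpow_le_rpow_of_exponent_le h' h.q_lt_p.le
      linarith
  have h5 : 0 ≤ ∫ x in Ω, |u x| ^ (r - 2) * (φ x * u x) := by
    refine integral_nonneg_of_ae ?_
    filter_upwards [hu0, hφ0] with x hx hx'
    exact mul_nonneg (by positivity) (mul_nonneg hx' hx)
  have h6 := mul_le_mul_of_nonneg_left
    (h2.trans (add_le_add_right (h4.trans (add_le_add_right h3 _)) _)) hβ.le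
  rw [regularVariation]
  linarith

/-- The bound on `∫ u^(-δ) φ` for nonnegative test functions passes to arbitrary directions by
Fatou's lemma, through the smooth regularizations of `|φ|`. -/
theorem integrableOn_singular (h : IsAdmissible Ω p q r δ) (hβ : 0 < β) (hlam : 0 < lam)
    (hu : MemW1p0 Ω p u) (hu0 : ∀ᵐ x ∂(volume.restrict Ω), 0 < u x)
    (hmin : ∀ φ, MemW1p0 Ω p φ → IsDirectionalMin Ω p q r δ β lam u φ)
    (hφ : MemW1p0 Ω p φ) : IntegrableOn (fun x => u x ^ (-δ) * φ x) Ω := by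
  have hp := h.one_lt_p
  have hu0' : ∀ᵐ x ∂(volume.restrict Ω), 0 ≤ u x := hu0.mono fun x hx => hx.le
  have hum := hu.1.1.1.aemeasurable
  obtain ⟨θ, hθ, hlim, hbd⟩ := hφ.exists_seq_testFunction hp.le
  set M := eLpNorm (weakGradient Ω φ) (ENNReal.ofReal p) (volume.restrict Ω) + 1 with hMdef
  have hM : M ≠ ⊤ := ENNReal.add_ne_top.2 ⟨hφ.1.2.2.2.ne, by simp⟩
  set C := (∫ x in Ω, ‖weakGradient Ω u x‖ ^ p) + M.toReal ^ p +
      β * ((∫ x in Ω, ‖weakGradient Ω u x‖ ^ q) + ((volume.restrict Ω).real univ + M.toReal ^ p))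
    with hC
  have hη : ∀ k : ℕ, (0 : ℝ) < 1 / ((k : ℝ) + 1) := fun k => Nat.one_div_pos_of_nat
  set ψ : ℕ → EuclideanSpace ℝ (Fin n) → ℝ := fun k => smoothAbs (1 / ((k : ℝ) + 1)) (θ k) with hψ
  have hψt : ∀ k, IsTestFunction Ω (ψ k) := fun k => (hθ k).smoothAbs (hη k)
  have hψle : ∀ k, ∫⁻ x in Ω, ENNReal.ofReal (u x) ^ (-δ) * ENNReal.ofReal (ψ k x) ≤
      ENNReal.ofReal (C / lam) := fun k => by
    have hψ0 : ∀ᵐ x ∂(volume.restrict Ω), 0 ≤ ψ k x := ae_of_all _ fun x => smoothAbs_nonneg _ x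
    have hψm : MemW1p0 Ω p (ψ k) := (hψt k).memW1p0 h.isOpen
    refine (h.lintegral_singular_le hlam hu hu0' hψm hψ0 (hmin _ hψm)).trans
      (ENNReal.ofReal_le_ofReal ?_)
    refine div_le_div_of_nonneg_right (h.regularVariation_le hβ hu hu0' hψm hψ0 hM ?_) hlam.le
    rw [eLpNorm_congr_ae ((hψt k).hasWeakGradient.weakGradient_ae_eq h.isOpen)]
    exact (eLpNorm_mono fun x => (hθ k).norm_gradient_smoothAbs_le (hη k) x).trans (hbd k)
  have hψlim : ∀ᵐ x ∂(volume.restrict Ω), Tendsto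
      (fun k => ENNReal.ofReal (u x) ^ (-δ) * ENNReal.ofReal (ψ k x)) atTop
      (𝓝 (ENNReal.ofReal (u x) ^ (-δ) * ENNReal.ofReal |φ x|)) := by
    filter_upwards [hlim, hu0] with x hx hux
    have hne : ENNReal.ofReal (u x) ^ (-δ) ≠ ⊤ := by
      rw [ENNReal.ofReal_rpow_of_pos hux]
      exact ENNReal.ofReal_ne_top
    refine ENNReal.Tendsto.const_mul (ENNReal.tendsto_ofReal ?_) (Or.inr hne)
    have h1 : Tendsto (fun k => ψ k x - |θ k x|) atTop (𝓝 0) :=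
      squeeze_zero_norm (fun k => abs_smoothAbs_sub_abs_le (hη k) x)
        tendsto_one_div_add_atTop_nhds_zero_nat
    simpa using h1.add hx.abs
  have hfin : ∫⁻ x in Ω, ENNReal.ofReal (u x) ^ (-δ) * ENNReal.ofReal |φ x| ≤
      ENNReal.ofReal (C / lam) :=
    calc ∫⁻ x in Ω, ENNReal.ofReal (u x) ^ (-δ) * ENNReal.ofReal |φ x|
        = ∫⁻ x in Ω, liminf (fun k =>
            ENNReal.ofReal (u x) ^ (-δ) * ENNReal.ofReal (ψ k x)) atTop := by
          refine lintegral_congr_ae ?_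
          filter_upwards [hψlim] with x hx using hx.liminf_eq.symm
      _ ≤ liminf (fun k => ∫⁻ x in Ω,
            ENNReal.ofReal (u x) ^ (-δ) * ENNReal.ofReal (ψ k x)) atTop :=
          lintegral_liminf_le' fun k => (hum.ennreal_ofReal.pow_const _).mul
            (hψt k).1.continuous.measurable.ennreal_ofReal.aemeasurable
      _ ≤ liminf (fun _ : ℕ => ENNReal.ofReal (C / lam)) atTop :=
          liminf_le_liminf (Eventually.of_forall hψle)
      _ = ENNReal.ofReal (C / lam) := tendsto_const_nhds.liminf_eq
  refine ⟨(hum.pow_const _).aestronglyMeasurable.mul hφ.1.1.1, ?_⟩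
  refine (le_of_eq (lintegral_congr_ae ?_)).trans_lt (hfin.trans_lt ENNReal.ofReal_lt_top)
  filter_upwards [hu0] with x hx
  rw [ENNReal.ofReal_rpow_of_pos hx, ← ENNReal.ofReal_mul (by positivity),
    Real.enorm_eq_ofReal_abs, abs_mul, abs_of_pos (Real.rpow_pos_of_pos hx _)]

/-! ### The Euler–Lagrange equation -/

/-- The one-sided Euler–Lagrange inequality for a direction of arbitrary sign. Once `u^(-δ) φ` is
integrable it dominates the difference quotients of `∫ |u + ε φ|^(1-δ)`. -/
theorem integral_singular_le (h : IsAdmissible Ω p q r δ)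
    (hu : MemW1p0 Ω p u) (hu0 : ∀ᵐ x ∂(volume.restrict Ω), 0 < u x)
    (hφ : MemW1p0 Ω p φ) (hmin : IsDirectionalMin Ω p q r δ β lam u φ)
    (hint : IntegrableOn (fun x => u x ^ (-δ) * φ x) Ω) :
    lam * ∫ x in Ω, u x ^ (-δ) * φ x ≤ regularVariation Ω p q r β u φ := by
  obtain ⟨ε, K, hε, hε0, hK, hle⟩ := h.exists_quotient_le hu hφ hmin
  have hδ : 0 < 1 - δ := by linarith [h.δ_lt_one]
  have hδ1 : 1 - δ ≤ 1 := by linarith [h.δ_pos]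
  have hεn : Tendsto ε atTop (𝓝[≠] 0) :=
    tendsto_nhdsWithin_iff.2 ⟨hε0, Eventually.of_forall fun k => (hε k).ne'⟩
  have i1 := fun k => h.integrable_abs_rpow (hu.add_smul h.isOpen h.one_lt_p.le hφ (ε k))
  have i2 := h.integrable_abs_rpow hu
  have hlim : Tendsto (fun k => ∫ x in Ω,
      (ε k)⁻¹ * (|u x + ε k * φ x| ^ (1 - δ) - |u x| ^ (1 - δ))) atTop
      (𝓝 (∫ x in Ω, (1 - δ) * (u x ^ (-δ) * φ x))) := by
    refine tendsto_integral_of_dominated_convergence (fun x => |u x ^ (-δ) * φ x|)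
      (fun k => (((i1 k).sub i2).const_mul _).1) hint.abs (fun k => ?_) ?_
    · filter_upwards [hu0] with x hx
      have key := abs_abs_add_rpow_sub_le_mul (h := ε k * φ x) hx hδ.le hδ1
      rw [show 1 - δ - 1 = -δ by ring, abs_mul, abs_of_pos (hε k)] at key
      rw [Real.norm_eq_abs, abs_mul, abs_inv, abs_of_pos (hε k), abs_mul,
        abs_of_pos (Real.rpow_pos_of_pos hx _), abs_of_pos hx, inv_mul_le_iff₀ (hε k)]
      linarith
    · filter_upwards [hu0] with x hx
      have hd : HasDerivAt (fun t : ℝ => (u x + t * φ x) ^ (1 - δ))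
          ((1 - δ) * (u x ^ (-δ) * φ x)) 0 := by
        have h1 : HasDerivAt (fun t : ℝ => u x + t * φ x) (φ x) 0 := by
          simpa using ((hasDerivAt_id (0 : ℝ)).mul_const (φ x)).const_add (u x)
        refine (h1.rpow_const (p := 1 - δ) (Or.inl (by simpa using hx.ne'))).congr_deriv ?_
        simp only [zero_mul, add_zero]
        rw [show 1 - δ - 1 = -δ by ring]
        ring
      have hcont : Tendsto (fun t : ℝ => u x + t * φ x) (𝓝 0) (𝓝 (u x)) := by
        have : Continuous fun t : ℝ => u x + t * φ x := by fun_prop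
        simpa using this.tendsto 0
      have hd2 : HasDerivAt (fun t : ℝ => |u x + t * φ x| ^ (1 - δ))
          ((1 - δ) * (u x ^ (-δ) * φ x)) 0 := by
        refine hd.congr_of_eventuallyEq ?_
        filter_upwards [hcont.eventually (lt_mem_nhds hx)] with t ht
        rw [abs_of_pos ht]
      simpa [Function.comp_def] using hd2.tendsto_slope_zero.comp hεn
  have hq : ∀ k, lam / (1 - δ) * ∫ x in Ω,
      (ε k)⁻¹ * (|u x + ε k * φ x| ^ (1 - δ) - |u x| ^ (1 - δ)) ≤ K k := fun k => by
    refine le_trans (le_of_eq ?_) (hle k)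
    simp only [coeffs]
    rw [integral_const_mul, integral_sub (i1 k) i2]
  have := le_of_tendsto_of_tendsto' (hlim.const_mul (lam / (1 - δ))) hK hq
  rwa [integral_const_mul, ← mul_assoc, div_mul_cancel₀ _ hδ.ne'] at this

theorem regularVariation_neg (h : IsAdmissible Ω p q r δ) (hφ : MemW1p0 Ω p φ) :
    regularVariation Ω p q r β u (fun x => -1 * φ x) = -regularVariation Ω p q r β u φ := by
  have e : ∀ a : ℝ, ∫ x in Ω, ‖weakGradient Ω u x‖ ^ a *
      inner ℝ (weakGradient Ω u x) (weakGradient Ω (fun x => -1 * φ x) x) =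
      -∫ x in Ω, ‖weakGradient Ω u x‖ ^ a *
        inner ℝ (weakGradient Ω u x) (weakGradient Ω φ x) := fun a => by
    rw [← integral_neg]
    refine integral_congr_ae ?_
    filter_upwards [hφ.weakGradient_const_mul h.isOpen (-1)] with x hx
    rw [hx, inner_smul_right]
    ring
  have e2 : ∫ x in Ω, |u x| ^ (r - 2) * (-1 * φ x * u x) =
      -∫ x in Ω, |u x| ^ (r - 2) * (φ x * u x) := by
    rw [← integral_neg]
    congr 1
    ext x
    ring
  rw [regularVariation, regularVariation, e, e, e2]
  ring

theorem isWeakSolution_of_isDirectionalMin (h : IsAdmissible Ω p q r δ) (hβ : 0 < β)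
    (hlam : 0 < lam) (hu : MemW1p0 Ω p u) (hu0 : ∀ᵐ x ∂(volume.restrict Ω), 0 ≤ u x)
    (hmin : ∀ φ, MemW1p0 Ω p φ → IsDirectionalMin Ω p q r δ β lam u φ) :
    IsWeakSolution Ω p q r δ β lam u := by
  have hpos := h.ae_pos hlam hu hu0 hmin
  refine ⟨hu, hpos, fun φ hφ => ?_⟩
  have hint := h.integrableOn_singular hβ hlam hu hpos hmin hφ
  refine ⟨hint, ?_⟩
  have hφ' := hφ.const_mul h.isOpen h.one_lt_p.le (-1)
  have h1 := h.integral_singular_le hu hpos hφ (hmin φ hφ) hint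
  have h2 := h.integral_singular_le hu hpos hφ' (hmin _ hφ')
    (h.integrableOn_singular hβ hlam hu hpos hmin hφ')
  have e : ∫ x in Ω, u x ^ (-δ) * (-1 * φ x) = -∫ x in Ω, u x ^ (-δ) * φ x := by
    rw [← integral_neg]
    congr 1
    ext x
    ring
  rw [h.regularVariation_neg hφ, e] at h2
  have heq : regularVariation Ω p q r β u φ - lam * ∫ x in Ω, u x ^ (-δ) * φ x = 0 := by
    linarith
  have hpow : (fun x => u x ^ (r - 1) * φ x) =ᵐ[volume.restrict Ω]
      fun x => |u x| ^ (r - 2) * (φ x * u x) := by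
    filter_upwards [hpos] with x hx
    rw [abs_of_pos hx, show r - 1 = r - 2 + 1 by ring, Real.rpow_add_one hx.ne']
    ring
  have ip := (h.hasDerivAt_gradient_p hu hφ).1
  have iq := (h.hasDerivAt_gradient_q hu hφ).1
  have ir := (h.hasDerivAt_rpow_r hu hφ).1
  have i1 : IntegrableOn (fun x => ‖weakGradient Ω u x‖ ^ (p - 2) *
        inner ℝ (weakGradient Ω u x) (weakGradient Ω φ x)
      + β * (‖weakGradient Ω u x‖ ^ (q - 2) *
        inner ℝ (weakGradient Ω u x) (weakGradient Ω φ x))) Ω := ip.add (iq.const_mul β)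
  have i2 : IntegrableOn (fun x => ‖weakGradient Ω u x‖ ^ (p - 2) *
        inner ℝ (weakGradient Ω u x) (weakGradient Ω φ x)
      + β * (‖weakGradient Ω u x‖ ^ (q - 2) *
        inner ℝ (weakGradient Ω u x) (weakGradient Ω φ x))
      - lam * (u x ^ (-δ) * φ x)) Ω := i1.sub (hint.const_mul lam)
  rw [integral_sub i2 (ir.congr hpow.symm), integral_sub i1 (hint.const_mul lam),
    integral_add ip (iq.const_mul β), integral_const_mul, integral_const_mul,
    integral_congr_ae hpow]
  rw [regularVariation] at heq
  linarith

end IsAdmissible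

end SingularPQ

theorem theorem3p7 {n : ℕ} (Ω : Set (EuclideanSpace ℝ (Fin n)))
    (hΩo : IsOpen Ω) (hΩc : IsConnected Ω) (hΩb : Bornology.IsBounded Ω)
    (p q r δ β lam : ℝ)
    (hq : 1 < q) (hqp : q < p) (hpn : p < n)
    (hpr : p < r) (hr : r ≤ n * p / (n - p))
    (hδ0 : 0 < δ) (hδ1 : δ < 1) (hβ : 0 < β) (hlam : 0 < lam) :
    (∀ u ∈ SingularPQ.nehariPlus Ω p q r δ β lam,
      (∀ᵐ x ∂(volume.restrict Ω), 0 ≤ u x) →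
      (∀ w ∈ SingularPQ.nehariPlus Ω p q r δ β lam,
        SingularPQ.energy Ω p q r δ β lam u ≤ SingularPQ.energy Ω p q r δ β lam w) →
      SingularPQ.IsWeakSolution Ω p q r δ β lam u) ∧
    (∀ v ∈ SingularPQ.nehariMinus Ω p q r δ β lam,
      (∀ᵐ x ∂(volume.restrict Ω), 0 ≤ v x) →
      (∀ w ∈ SingularPQ.nehariMinus Ω p q r δ β lam,
        SingularPQ.energy Ω p q r δ β lam v ≤ SingularPQ.energy Ω p q r δ β lam w) →
      SingularPQ.IsWeakSolution Ω p q r δ β lam v) := by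
  have h : SingularPQ.IsAdmissible Ω p q r δ := ⟨hΩo, hΩb, hq, hqp, hpn, hpr, hr, hδ0, hδ1⟩
  exact ⟨fun u hu hu0 hmin => h.isWeakSolution_of_isDirectionalMin hβ hlam hu.1.1 hu0
      fun _ hφ => h.isDirectionalMin_of_nehariPlus hu hmin hφ,
    fun v hv hv0 hmin => h.isWeakSolution_of_isDirectionalMin hβ hlam hv.1.1 hv0
      fun _ hφ => h.isDirectionalMin_of_nehariMinus hv hmin hφ⟩
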